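/- Let $N\ge 1$, let $a_{i,j}$ and $b_{i,j}$ ($1\le i,j\le N$) be the coordinates on pairs $(\mathbb A,B)$ of complex $N\times N$ matrices, and let $K=\mathbb C(a_{i,j},b_{i,j})$ be the field of rational functions of the pair. Let $E_{i,j}$ be the matrix units and $$r_{12}=2\sum_{i,j}\theta(i-j)\,E_{i,j}\otimes E_{j,i},\qquad \theta(x)=1,\ \tfrac12,\ 0\ \text{ for } x>0,\ x=0,\ x<0 .$$ For a matrix $X$ put $X_1=X\otimes E$ and $X_2=E\otimes X$, with $E$ the identity matrix, and let $t_i$ denote transposition in the $i$-th tensor factor. The type-(ii) Poisson bracket on $K$ is the antisymmetric $\mathbb C$-bilinear biderivation determined by $$\{\mathbb A\overset{\otimes}{,}\mathbb A\}=r_{12}\mathbb A_1\mathbb A_2-\mathbb A_1\mathbb A_2r_{12}+\mathbb A_1r_{12}^{t_1}\mathbb A_2-\mathbb A_2r_{12}^{t_1}\mathbb A_1,$$ $$\{B\overset{\otimes}{,}B\}=r_{12}B_1B_2-B_1B_2r_{12},\qquad \{B\overset{\otimes}{,}\mathbb A\}=B_1Q_{12}\mathbb A_2+B_1\mathbb A_2Q_{12}^{t_2},\quad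 Q_{12}=-r_{12}^{t_2},$$ where the entry of $\{X\overset{\otimes}{,}Y\}$ in row $(i,k)$ and column $(j,l)$ is $\{x_{i,j},y_{k,l}\}$. An element $f\in K$ is a Casimir function if $\{f,g\}=0$ for all $g\in K$. **Theorem.** The following $2[N/2]$ elements of $K$ are Casimir functions of the type-(ii) bracket, and they are algebraically independent over $\mathbb C$: * the $[N/2]$ coefficients $Y_p$, $p=1,\dots,[N/2]$, of the $\lambda$-expansion $$\frac{\det(\lambda\mathbb A+\lambda^{-1}\mathbb A^{\mathrm T})}{\det\mathbb A}=(\lambda^N+\lambda^{-N})+\sum_{p=1}^{[N/2]}\bigl(\lambda^{N-2p}+\lambda^{2p-N}\bigr)Y_p ;$$ * the $[N/2]$ functions $$X_p=\frac{M_S^p\,M_S^{N-p}}{M_B^{N-p}\,M_B^p}\cdot\frac{(\det B)^2}{\det\mathbb A},\qquad p=1,\dots,[N/2],$$ where $M_S^q$ is the upper-left (principal) $q\times q$ minor of $S=\mathbb A^{\mathrm T}B^{-1}$ and $M_B^q$ is the upper-right $q\times q$ minor of $B$. -/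

import Mathlib

open scoped Kronecker

namespace BilinearPoisson

noncomputable section

/-- The coordinates on pairs of `N × N` matrices `(𝔸, B)`: the variable `Sum.inl (i, j)` is the
entry `a i j` of `𝔸`, the variable `Sum.inr (i, j)` is the entry `b i j` of `B`. -/
abbrev Coord (N : ℕ) : Type := (Fin N × Fin N) ⊕ (Fin N × Fin N)

/-- Polynomial functions of the pair `(𝔸, B)`. -/
abbrev PolyFun (N : ℕ) : Type := MvPolynomial (Coord N) ℂ

/-- Rational functions of the pair `(𝔸, B)`. -/
abbrev RatFun (N : ℕ) : Type := FractionRing (PolyFun N)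

variable {N : ℕ}

/-- A coordinate, as a rational function. -/
def coord (x : Coord N) : RatFun N := algebraMap (PolyFun N) (RatFun N) (MvPolynomial.X x)

variable (N) in
/-- The generic matrix `𝔸 = (a i j)`. -/
def matA : Matrix (Fin N) (Fin N) (RatFun N) := Matrix.of fun i j => coord (Sum.inl (i, j))

variable (N) in
/-- The generic matrix `B = (b i j)`. -/
def matB : Matrix (Fin N) (Fin N) (RatFun N) := Matrix.of fun i j => coord (Sum.inr (i, j))

/-! ### Partial derivatives of rational functions -/

/-- The partial derivative of the rational function `num f / den f`, by the quotient rule. -/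
def ratPderivFun (x : Coord N) (f : RatFun N) : RatFun N :=
  (algebraMap (PolyFun N) (RatFun N)
      (MvPolynomial.pderiv x (IsFractionRing.num (PolyFun N) f) *
          (IsFractionRing.den (PolyFun N) f : PolyFun N) -
        IsFractionRing.num (PolyFun N) f *
          MvPolynomial.pderiv x (IsFractionRing.den (PolyFun N) f : PolyFun N))) /
    algebraMap (PolyFun N) (RatFun N) (IsFractionRing.den (PolyFun N) f : PolyFun N) ^ 2

/-- The quotient rule holds for every presentation of a rational function as a fraction. -/
theorem ratPderivFun_div (x : Coord N) (p q : PolyFun N) (hq : q ≠ 0) :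
    ratPderivFun x (algebraMap (PolyFun N) (RatFun N) p / algebraMap (PolyFun N) (RatFun N) q) =
      algebraMap (PolyFun N) (RatFun N)
        (MvPolynomial.pderiv x p * q - p * MvPolynomial.pderiv x q) /
        algebraMap (PolyFun N) (RatFun N) q ^ 2 := by
  set f : RatFun N :=
    algebraMap (PolyFun N) (RatFun N) p / algebraMap (PolyFun N) (RatFun N) q with hf
  have hinj : Function.Injective (algebraMap (PolyFun N) (RatFun N)) :=
    IsFractionRing.injective _ _
  set n : PolyFun N := IsFractionRing.num (PolyFun N) f with hn
  set d : PolyFun N := (IsFractionRing.den (PolyFun N) f : PolyFun N) with hd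
  have hd0 : d ≠ 0 := nonZeroDivisors.coe_ne_zero _
  have hd' : algebraMap (PolyFun N) (RatFun N) d ≠ 0 := fun h => hd0 (hinj (by rw [h, map_zero]))
  have hq' : algebraMap (PolyFun N) (RatFun N) q ≠ 0 := fun h => hq (hinj (by rw [h, map_zero]))
  have hfr : f = algebraMap (PolyFun N) (RatFun N) n / algebraMap (PolyFun N) (RatFun N) d := by
    have h := IsFractionRing.mk'_num_den (PolyFun N) f
    rw [IsFractionRing.mk'_eq_div] at h
    exact h.symm
  have hcross : p * d = n * q := by
    apply hinj
    rw [map_mul, map_mul]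
    rw [hfr, div_eq_div_iff hd' hq'] at hf
    exact hf.symm
  have hder : MvPolynomial.pderiv x p * d + p * MvPolynomial.pderiv x d =
      MvPolynomial.pderiv x n * q + n * MvPolynomial.pderiv x q := by
    have h := congrArg (MvPolynomial.pderiv x) hcross
    rw [Derivation.leibniz, Derivation.leibniz] at h
    simp only [smul_eq_mul] at h
    linear_combination h
  have hmain : (MvPolynomial.pderiv x n * d - n * MvPolynomial.pderiv x d) * q ^ 2 =
      (MvPolynomial.pderiv x p * q - p * MvPolynomial.pderiv x q) * d ^ 2 := by
    linear_combination (-(q * d)) * hder +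
      (q * MvPolynomial.pderiv x d + d * MvPolynomial.pderiv x q) * hcross
  change algebraMap (PolyFun N) (RatFun N)
      (MvPolynomial.pderiv x n * d - n * MvPolynomial.pderiv x d) /
        algebraMap (PolyFun N) (RatFun N) d ^ 2 = _
  rw [div_eq_div_iff (pow_ne_zero 2 hd') (pow_ne_zero 2 hq'), ← map_pow, ← map_pow, ← map_mul,
    ← map_mul, hmain]

/-- Every rational function is a quotient of polynomials. -/
theorem exists_div (f : RatFun N) : ∃ p q : PolyFun N, q ≠ 0 ∧
    f = algebraMap (PolyFun N) (RatFun N) p / algebraMap (PolyFun N) (RatFun N) q := by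
  obtain ⟨p, q, hq, h⟩ := IsFractionRing.div_surjective (A := PolyFun N) f
  exact ⟨p, q, nonZeroDivisors.ne_zero hq, h.symm⟩

theorem algebraMap_ne_zero {q : PolyFun N} (hq : q ≠ 0) :
    algebraMap (PolyFun N) (RatFun N) q ≠ 0 := fun h =>
  hq (IsFractionRing.injective (PolyFun N) (RatFun N) (by rw [h, map_zero]))

theorem ratPderivFun_poly (x : Coord N) (p : PolyFun N) :
    ratPderivFun x (algebraMap (PolyFun N) (RatFun N) p) =
      algebraMap (PolyFun N) (RatFun N) (MvPolynomial.pderiv x p) := by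
  have h := ratPderivFun_div x p 1 one_ne_zero
  simpa using h

theorem ratPderivFun_add (x : Coord N) (f g : RatFun N) :
    ratPderivFun x (f + g) = ratPderivFun x f + ratPderivFun x g := by
  obtain ⟨p, q, hq, rfl⟩ := exists_div f
  obtain ⟨p', q', hq', rfl⟩ := exists_div g
  have h1 := algebraMap_ne_zero hq
  have h2 := algebraMap_ne_zero hq'
  rw [div_add_div _ _ h1 h2, ← map_mul, ← map_mul, ← map_mul, ← map_add,
    ratPderivFun_div x _ _ (mul_ne_zero hq hq'), ratPderivFun_div x _ _ hq,
    ratPderivFun_div x _ _ hq', div_add_div _ _ (pow_ne_zero 2 h1) (pow_ne_zero 2 h2),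
    div_eq_div_iff (pow_ne_zero 2 (algebraMap_ne_zero (mul_ne_zero hq hq')))
      (mul_ne_zero (pow_ne_zero 2 h1) (pow_ne_zero 2 h2))]
  simp only [Derivation.leibniz, smul_eq_mul, map_add, map_sub, map_mul]
  ring

theorem ratPderivFun_mul (x : Coord N) (f g : RatFun N) :
    ratPderivFun x (f * g) = f * ratPderivFun x g + g * ratPderivFun x f := by
  obtain ⟨p, q, hq, rfl⟩ := exists_div f
  obtain ⟨p', q', hq', rfl⟩ := exists_div g
  have h1 := algebraMap_ne_zero hq
  have h2 := algebraMap_ne_zero hq'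
  rw [div_mul_div_comm, ← map_mul, ← map_mul,
    ratPderivFun_div x _ _ (mul_ne_zero hq hq'), ratPderivFun_div x _ _ hq,
    ratPderivFun_div x _ _ hq']
  simp only [Derivation.leibniz, smul_eq_mul, map_add, map_sub, map_mul]
  field_simp
  ring

/-- The partial derivative with respect to a coordinate, as a derivation of the field of rational
functions. -/
def ratPderiv (x : Coord N) : Derivation ℂ (RatFun N) (RatFun N) where
  toFun := ratPderivFun x
  map_add' := ratPderivFun_add x
  map_smul' c f := by
    have hc : (algebraMap ℂ (RatFun N) c) =
        algebraMap (PolyFun N) (RatFun N) (MvPolynomial.C c) := by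
      rw [IsScalarTower.algebraMap_apply ℂ (PolyFun N) (RatFun N), MvPolynomial.algebraMap_eq]
    simp [Algebra.smul_def, hc, ratPderivFun_mul, ratPderivFun_poly]
  map_one_eq_zero' := by
    have h := ratPderivFun_poly x 1
    simpa using h
  leibniz' f g := by simpa using ratPderivFun_mul x f g

/-- `∂ y / ∂ x` is the Kronecker delta on coordinates. -/
theorem ratPderiv_coord (x y : Coord N) :
    ratPderiv x (coord y) = if x = y then 1 else 0 := by
  change ratPderivFun x (coord y) = _
  rw [coord, ratPderivFun_poly, MvPolynomial.pderiv_X]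
  rcases eq_or_ne x y with rfl | h
  · simp
  · simp [h]

/-! ### The `r`-matrix and the bracket -/

/-- Endomorphisms of `V ⊗ V`, `V` of dimension `N`, with rational functions as entries. The entry
in row `(i, k)` and column `(j, l)` of `X ⊗ₖ Y` is `X i j * Y k l`. -/
abbrev TensorMat (N : ℕ) : Type :=
  Matrix (Fin N × Fin N) (Fin N × Fin N) (RatFun N)

/-- `θ (i - j)`, with `θ x = 1, 1/2, 0` for `x > 0`, `x = 0`, `x < 0`. -/
def theta (i j : Fin N) : RatFun N := if j < i then 1 else if i = j then 1 / 2 else 0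

variable (N) in
/-- The trigonometric `r`-matrix `r₁₂ = 2 ∑ θ (i - j) E i j ⊗ E j i`. -/
def rMat : TensorMat N :=
  ∑ i : Fin N, ∑ j : Fin N,
    (2 * theta i j) • (Matrix.single i j (1 : RatFun N) ⊗ₖ Matrix.single j i (1 : RatFun N))

/-- Transposition in the first tensor factor. -/
def transpose₁ (M : TensorMat N) : TensorMat N := Matrix.of fun p q => M (q.1, p.2) (p.1, q.2)

/-- Transposition in the second tensor factor. -/
def transpose₂ (M : TensorMat N) : TensorMat N := Matrix.of fun p q => M (p.1, q.2) (q.1, p.2)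

/-- `X ⊗ E`. -/
def sheet₁ (X : Matrix (Fin N) (Fin N) (RatFun N)) : TensorMat N :=
  X ⊗ₖ (1 : Matrix (Fin N) (Fin N) (RatFun N))

/-- `E ⊗ X`. -/
def sheet₂ (X : Matrix (Fin N) (Fin N) (RatFun N)) : TensorMat N :=
  (1 : Matrix (Fin N) (Fin N) (RatFun N)) ⊗ₖ X

variable (N) in
/-- The tensor `{𝔸 ⊗, 𝔸}`; its entry in row `(i, k)` and column `(j, l)` is `{a i j, a k l}`. -/
def tensorAA : TensorMat N :=
  rMat N * (sheet₁ (matA N) * sheet₂ (matA N)) - (sheet₁ (matA N) * sheet₂ (matA N)) * rMat N +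
    sheet₁ (matA N) * transpose₁ (rMat N) * sheet₂ (matA N) -
    sheet₂ (matA N) * transpose₁ (rMat N) * sheet₁ (matA N)

variable (N) in
/-- The tensor `{B ⊗, B}`; its entry in row `(i, k)` and column `(j, l)` is `{b i j, b k l}`. -/
def tensorBB : TensorMat N :=
  rMat N * (sheet₁ (matB N) * sheet₂ (matB N)) - (sheet₁ (matB N) * sheet₂ (matB N)) * rMat N

variable (N) in
/-- The matrix `Q₁₂ = - r₁₂ ^ t₂` of type (ii). -/
def qMat : TensorMat N := -transpose₂ (rMat N)

variable (N) in
/-- The tensor `{B ⊗, 𝔸}`; its entry in row `(i, k)` and column `(j, l)` is `{b i j, a k l}`. -/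
def tensorBA : TensorMat N :=
  sheet₁ (matB N) * qMat N * sheet₂ (matA N) +
    sheet₁ (matB N) * sheet₂ (matA N) * transpose₂ (qMat N)

/-- The brackets of the coordinates. -/
def coordBracket : Coord N → Coord N → RatFun N
  | Sum.inl (i, j), Sum.inl (k, l) => tensorAA N (i, k) (j, l)
  | Sum.inr (i, j), Sum.inr (k, l) => tensorBB N (i, k) (j, l)
  | Sum.inr (i, j), Sum.inl (k, l) => tensorBA N (i, k) (j, l)
  | Sum.inl (k, l), Sum.inr (i, j) => -tensorBA N (i, k) (j, l)

/-- The type-(ii) bracket on rational functions of `(𝔸, B)`: the biderivation with the above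
values on coordinates. -/
def bracket (f g : RatFun N) : RatFun N :=
  ∑ x : Coord N, ∑ y : Coord N, coordBracket x y * ratPderiv x f * ratPderiv y g

/-- The bracket takes the prescribed values on coordinates. -/
theorem bracket_coord (x y : Coord N) : bracket (coord x) (coord y) = coordBracket x y := by
  simp [bracket, ratPderiv_coord]

/-- A Casimir function: a rational function which commutes with all rational functions. -/
def IsCasimir (f : RatFun N) : Prop := ∀ g : RatFun N, bracket f g = 0

/-! ### The two families -/

/-- The upper-left `q × q` minor. -/
def upperLeftMinor (M : Matrix (Fin N) (Fin N) (RatFun N)) (q : ℕ) (hq : q ≤ N) : RatFun N :=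
  (Matrix.of fun i j : Fin q => M (Fin.castLE hq i) (Fin.castLE hq j)).det

/-- The upper-right `q × q` minor. -/
def upperRightMinor (M : Matrix (Fin N) (Fin N) (RatFun N)) (q : ℕ) (hq : q ≤ N) : RatFun N :=
  (Matrix.of fun i j : Fin q => M (Fin.castLE hq i) ⟨N - q + j, by omega⟩).det

variable (N) in
/-- `S = 𝔸ᵀ B⁻¹`. -/
def matS : Matrix (Fin N) (Fin N) (RatFun N) := (matA N).transpose * (matB N)⁻¹

open LaurentPolynomial in
variable (N) in
/-- The Laurent polynomial `det (λ 𝔸 + λ⁻¹ 𝔸ᵀ) / det 𝔸` in `λ`. -/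
def charLaurent : LaurentPolynomial (RatFun N) :=
  ((T 1 : LaurentPolynomial (RatFun N)) •
        (matA N).map (C : RatFun N →+* LaurentPolynomial (RatFun N)) +
      (T (-1) : LaurentPolynomial (RatFun N)) • (matA N).transpose.map
        (C : RatFun N →+* LaurentPolynomial (RatFun N))).det *
    C ((matA N).det)⁻¹

/-- `Y_p` for `p = 1, …, [N/2]` (the index `p : Fin (N / 2)` stands for `p + 1`): the coefficient
of `λ ^ (N - 2p)` in `det (λ 𝔸 + λ⁻¹ 𝔸ᵀ) / det 𝔸`, halved if `2p = N`, because then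
`λ ^ (N - 2p) + λ ^ (2p - N) = 2`. -/
def casimirY (p : Fin (N / 2)) : RatFun N :=
  (charLaurent N).coeff ((N : ℤ) - 2 * ((p : ℤ) + 1)) / (if 2 * ((p : ℕ) + 1) = N then 2 else 1)

/-- `X_p` for `p = 1, …, [N/2]` (the index `p : Fin (N / 2)` stands for `p + 1`). -/
def casimirX (p : Fin (N / 2)) : RatFun N :=
  (upperLeftMinor (matS N) (p + 1) (by omega) * upperLeftMinor (matS N) (N - (p + 1)) (by omega)) /
      (upperRightMinor (matB N) (N - (p + 1)) (by omega) *
        upperRightMinor (matB N) (p + 1) (by omega)) *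
    ((matB N).det ^ 2 / (matA N).det)

end

end BilinearPoisson

/-! A function is Casimir as soon as the Hamiltonian field of every coordinate kills it. Along each
such field `𝔸` moves by an infinitesimal congruence `X𝔸 + 𝔸Xᵀ` (`exists_hamiltonian_matA`), so all
coefficients of `det (λ𝔸 + λ⁻¹𝔸ᵀ)` scale at the same rate `2 tr X` as `det 𝔸`, and their ratios, the
`Y_p`, are constant.

At the same time `B` is moved by lower triangular matrices on both sides, and `S` by a lower
triangular one on the left and an upper triangular one on the right (`TriangularAction`). These are
the motions under which upper-right minors of `B` and upper-left minors of `S` are merely rescaled,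
at rates that are partial sums of diagonal entries. The diagonals match, so the orders `p` and `N -
p` together complete these sums to traces, which the determinants cancel
(`TriangularAction.casimirX_eq_zero`).

Independence holds because the functions jointly take all values in a product of infinite sets
(`algebraicIndependent_of_hasValue`). The test points have `A`, `B` antidiagonal and `S` diagonal.
The pencil determinant of `A` is then an explicit product, and factoring palindromic Laurent
polynomials over `ℂ` realises any values of the `Y_p`. With `A` fixed, the diagonal of `S` remains
free, and extracting roots realises any nonzero values of the `X_p`. -/

namespace BilinearPoisson

/-! ### Derivations and determinants -/

section Derivation

variable {R K : Type*} [CommRing R] [CommRing K] [Algebra R K]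

/-- The ring homomorphism `f ↦ f + ε D f` into the dual numbers. -/
def dualHom (D : Derivation R K K) : K →+* DualNumber K where
  toFun f := TrivSqZeroExt.inl f + TrivSqZeroExt.inr (D f)
  map_one' := by simp
  map_zero' := by simp
  map_add' f g := by ext <;> simp
  map_mul' f g := by ext <;> simp [mul_comm]

theorem snd_dualHom (D : Derivation R K K) (f : K) :
    TrivSqZeroExt.snd (dualHom D f) = D f := by
  simp [dualHom]

theorem det_one_add_eps_smul {n : Type*} [Fintype n] [DecidableEq n] (X : Matrix n n K) :
    (1 + (DualNumber.eps : DualNumber K) • X.map (TrivSqZeroExt.inlHom K K)).det =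
      1 + DualNumber.eps * TrivSqZeroExt.inl X.trace := by
  rw [Matrix.det_one_add_smul, pow_two, DualNumber.eps_mul_eps, mul_zero, add_zero, mul_comm]
  congr 2
  simpa using (AddMonoidHom.map_trace (TrivSqZeroExt.inlHom K K : K →+* DualNumber K).toAddMonoidHom X).symm

/-- The derivative of the determinant along `M ↦ G M + M W`. -/
theorem derivation_det {n : Type*} [Fintype n] [DecidableEq n] (D : Derivation R K K)
    (M G W : Matrix n n K) (h : M.map D = G * M + M * W) :
    D M.det = (G.trace + W.trace) * M.det := by
  -- Since `ε² = 0`, the perturbed matrix `M + ε D M` factors as `(1 + εG) M (1 + εW)`; the claim is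
  -- the `ε`-part of its determinant.
  have hM : M.map (dualHom D) = (1 + (DualNumber.eps : DualNumber K) • G.map (TrivSqZeroExt.inlHom K K)) *
      M.map (TrivSqZeroExt.inlHom K K) *
      (1 + (DualNumber.eps : DualNumber K) • W.map (TrivSqZeroExt.inlHom K K)) := by
    have h1 : M.map (dualHom D) = M.map (TrivSqZeroExt.inlHom K K) +
        (DualNumber.eps : DualNumber K) • (M.map D).map (TrivSqZeroExt.inlHom K K) := by
      ext i j <;> simp [dualHom]
    rw [h1, h, Matrix.map_add _ (map_add _), Matrix.map_mul, Matrix.map_mul]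
    simp only [add_mul, mul_add, one_mul, mul_one, smul_mul_assoc, mul_smul_comm, smul_add,
      smul_smul, DualNumber.eps_mul_eps, zero_smul, add_zero, add_assoc]
  have h2 := congrArg Matrix.det hM
  rw [Matrix.det_mul, Matrix.det_mul, det_one_add_eps_smul, det_one_add_eps_smul,
    ← RingHom.mapMatrix_apply, ← RingHom.mapMatrix_apply, ← RingHom.map_det,
    ← RingHom.map_det] at h2
  have h3 := congrArg TrivSqZeroExt.snd h2
  rw [snd_dualHom] at h3
  rw [h3]
  simp
  ring

/-- The vanishing conditions keep rows and columns outside the minor from leaking in, so the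
submatrix satisfies an equation of the same shape. -/
theorem derivation_det_submatrix {n m : Type*} [Fintype n] [DecidableEq n] [Fintype m]
    [DecidableEq m] (D : Derivation R K K) (M G W : Matrix n n K) (h : M.map D = G * M + M * W)
    (r c : m → n) (hr : Function.Injective r) (hc : Function.Injective c)
    (hG : ∀ i k, k ∉ Set.range r → G (r i) k = 0) (hW : ∀ j k, k ∉ Set.range c → W k (c j) = 0) :
    D (M.submatrix r c).det =
      (∑ i, G (r i) (r i) + ∑ j, W (c j) (c j)) * (M.submatrix r c).det := by
  refine derivation_det D _ (G.submatrix r r) (W.submatrix c c) ?_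
  ext i j
  have hij := congrFun (congrFun h (r i)) (c j)
  simp only [Matrix.map_apply, Matrix.add_apply, Matrix.mul_apply, Matrix.submatrix_apply] at hij ⊢
  rw [hij]
  congr 1
  · exact (Fintype.sum_of_injective r hr _ _ (fun k hk => by rw [hG i k hk, zero_mul])
      fun k => rfl).symm
  · exact (Fintype.sum_of_injective c hc _ _ (fun k hk => by rw [hW j k hk, mul_zero])
      fun k => rfl).symm

theorem map_derivation_mul {l m n : Type*} [Fintype m] (D : Derivation R K K)
    (M : Matrix l m K) (P : Matrix m n K) :
    (M * P).map D = M.map D * P + M * P.map D := by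
  ext i j
  simp only [Matrix.map_apply, Matrix.add_apply, Matrix.mul_apply, map_sum, Derivation.leibniz,
    smul_eq_mul, ← Finset.sum_add_distrib]
  exact Finset.sum_congr rfl fun k _ => by ring

end Derivation

section FieldDerivation

variable {R K : Type*} [CommRing R] [Field K] [Algebra R K] (D : Derivation R K K)

theorem derivation_mul_eigen {f g a b : K} (hf : D f = a * f) (hg : D g = b * g) :
    D (f * g) = (a + b) * (f * g) := by
  rw [Derivation.leibniz, hf, hg, smul_eq_mul, smul_eq_mul]
  ring

/-- The convention `f / 0 = 0` covers a vanishing denominator, so no minor has to be shown nonzero.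
-/
theorem derivation_div_eigen {f g a b : K} (hf : D f = a * f) (hg : D g = b * g) :
    D (f / g) = (a - b) * (f / g) := by
  rcases eq_or_ne g 0 with rfl | h
  · simp
  · rw [Derivation.leibniz_div, hf, hg, smul_eq_mul, smul_eq_mul, smul_eq_mul]
    field_simp

end FieldDerivation

noncomputable section

variable {N : ℕ}

/-! ### Coordinate brackets in closed form -/

theorem rMat_apply (i j k l : Fin N) :
    rMat N (i, k) (j, l) = if k = j ∧ l = i then 2 * theta i j else 0 := by
  simp only [rMat, Matrix.sum_apply, Matrix.smul_apply, Matrix.kroneckerMap_apply,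
    Matrix.single_apply, smul_eq_mul]
  rw [Finset.sum_eq_single i, Finset.sum_eq_single j]
  · simp only [and_true, ite_and, eq_comm (a := i) (b := l), eq_comm (a := j) (b := k)]
    split_ifs <;> simp
  · intro b _ hb
    simp [hb]
  · simp
  · intro b _ hb
    simp [hb]
  · simp

theorem tensorAA_apply (i j k l : Fin N) :
    tensorAA N (i, k) (j, l) =
      2 * (theta i k - theta l j) * (matA N i l * matA N k j) +
        2 * theta j k * (matA N i k * matA N j l) - 2 * theta l i * (matA N k i * matA N l j) := by
  simp only [tensorAA, sheet₁, sheet₂, transpose₁, Matrix.sub_apply, Matrix.add_apply,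
    Matrix.mul_apply, Fintype.sum_prod_type, Matrix.kroneckerMap_apply, rMat_apply,
    Matrix.of_apply, Matrix.one_apply]
  simp [ite_and, Finset.sum_ite_eq]
  ring

theorem tensorBB_apply (i j k l : Fin N) :
    tensorBB N (i, k) (j, l) =
      2 * (theta i k - theta l j) * (matB N i l * matB N k j) := by
  simp only [tensorBB, sheet₁, sheet₂, Matrix.sub_apply,
    Matrix.mul_apply, Fintype.sum_prod_type, Matrix.kroneckerMap_apply, rMat_apply,
    Matrix.one_apply]
  simp [ite_and, Finset.sum_ite_eq]
  ring

theorem tensorBA_apply (i j k l : Fin N) :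
    tensorBA N (i, k) (j, l) =
      -(2 * theta k j * (matB N i k * matA N j l)) - 2 * theta l j * (matB N i l * matA N k j) := by
  simp only [tensorBA, sheet₁, sheet₂, qMat, transpose₂, Matrix.add_apply, Matrix.neg_apply,
    Matrix.mul_apply, Fintype.sum_prod_type, Matrix.kroneckerMap_apply, rMat_apply,
    Matrix.of_apply, Matrix.one_apply]
  simp [ite_and, Finset.sum_ite_eq]
  ring

/-! ### Hamiltonian vector fields -/

/-- The Hamiltonian vector field `{·, y}` of a coordinate `y`. -/
def hamiltonian (y : Coord N) : Derivation ℂ (RatFun N) (RatFun N) :=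
  ∑ x : Coord N, coordBracket x y • ratPderiv x

theorem hamiltonian_apply (y : Coord N) (f : RatFun N) :
    hamiltonian y f = ∑ x : Coord N, coordBracket x y * ratPderiv x f := by
  rw [hamiltonian, ← Derivation.coeFnAddMonoidHom_apply, map_sum, Finset.sum_apply]
  rfl

theorem hamiltonian_coord (x y : Coord N) : hamiltonian y (coord x) = coordBracket x y := by
  simp [hamiltonian_apply, ratPderiv_coord]

theorem isCasimir_of_hamiltonian_eq_zero {f : RatFun N} (h : ∀ y, hamiltonian y f = 0) :
    IsCasimir f := fun g => by
  rw [bracket, Finset.sum_comm]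
  refine Finset.sum_eq_zero fun y _ => ?_
  rw [← Finset.sum_mul, ← hamiltonian_apply, h, zero_mul]

/-- This complementarity trades an upper triangular coefficient for a lower triangular one at the
cost of a rank-one matrix. -/
theorem theta_add_theta (i j : Fin N) : theta i j + theta j i = 1 := by
  rcases lt_trichotomy i j with h | rfl | h
  · simp [theta, h, h.not_gt, h.ne]
  · norm_num [theta]
  · simp [theta, h, h.not_gt, h.ne]

theorem theta_of_lt {i j : Fin N} (h : i < j) : theta i j = 0 := by
  simp [theta, h.not_gt, h.ne]

theorem two_mul_theta_self (i : Fin N) : 2 * theta i i = 1 := by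
  simp [theta]

theorem hamiltonian_inl_matA (k l : Fin N) (X : Matrix (Fin N) (Fin N) (RatFun N))
    (hX : ∀ i m, X i m = (if m = k then 2 * theta i k * matA N i l else 0) -
      (if m = l then 2 * theta l i * matA N k i else 0)) :
    (matA N).map (hamiltonian (Sum.inl (k, l))) = X * matA N + matA N * X.transpose := by
  ext i j
  simp only [Matrix.map_apply, Matrix.add_apply, Matrix.mul_apply, Matrix.transpose_apply, hX]
  rw [matA, Matrix.of_apply, hamiltonian_coord, coordBracket, tensorAA_apply, matA]
  simp [sub_mul, mul_sub, Finset.sum_sub_distrib]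
  ring

theorem hamiltonian_inr_matA (k l : Fin N) (X : Matrix (Fin N) (Fin N) (RatFun N))
    (hX : ∀ i m, X i m = if m = l then 2 * theta i l * matB N k i else 0) :
    (matA N).map (hamiltonian (Sum.inr (k, l))) = X * matA N + matA N * X.transpose := by
  ext i j
  simp only [Matrix.map_apply, Matrix.add_apply, Matrix.mul_apply, Matrix.transpose_apply, hX]
  rw [matA, Matrix.of_apply, hamiltonian_coord, coordBracket, tensorBA_apply, matA]
  simp
  ring

/-- The function `𝔸` is moved by infinitesimal congruences along Hamiltonian vector fields. -/
theorem exists_hamiltonian_matA (y : Coord N) : ∃ X : Matrix (Fin N) (Fin N) (RatFun N),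
    (matA N).map (hamiltonian y) = X * matA N + matA N * X.transpose := by
  rcases y with ⟨k, l⟩ | ⟨k, l⟩
  · exact ⟨_, hamiltonian_inl_matA k l (Matrix.of _) fun i m => rfl⟩
  · exact ⟨_, hamiltonian_inr_matA k l (Matrix.of _) fun i m => rfl⟩

/-- The matrix is the universal generic matrix with its variables renamed injectively, so its
determinant stays nonzero. -/
theorem det_coord_ne_zero (e : Fin N × Fin N → Coord N) (he : Function.Injective e) :
    (Matrix.of fun i j => coord (e (i, j)) : Matrix (Fin N) (Fin N) (RatFun N)).det ≠ 0 := by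
  have h : (Matrix.of fun i j => coord (e (i, j))) =
      ((algebraMap (PolyFun N) (RatFun N)).comp (MvPolynomial.rename (R := ℂ) e).toRingHom).mapMatrix
        (Matrix.mvPolynomialX (Fin N) (Fin N) ℂ) := by
    ext i j
    simp [coord]
  rw [h, ← RingHom.map_det]
  intro h0
  refine Matrix.det_mvPolynomialX_ne_zero (Fin N) ℂ (MvPolynomial.rename_injective e he ?_)
  refine IsFractionRing.injective (PolyFun N) (RatFun N) ?_
  rw [map_zero, map_zero]
  exact h0

theorem det_matA_ne_zero : (matA N).det ≠ 0 :=
  det_coord_ne_zero Sum.inl Sum.inl_injective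

theorem det_matB_ne_zero : (matB N).det ≠ 0 :=
  det_coord_ne_zero Sum.inr Sum.inr_injective

/-! ### Triangular actions and the functions `X_p` -/

theorem matS_mul_matB : matS N * matB N = (matA N).transpose := by
  rw [matS, Matrix.mul_assoc, Matrix.nonsing_inv_mul _ (isUnit_iff_ne_zero.mpr det_matB_ne_zero),
    Matrix.mul_one]

/-- Infinitesimal data by which a derivation moves `𝔸`, `B` and `S`: multiplication by triangular
matrices for `B` and `S`, with matching diagonals. -/
structure TriangularAction (D : Derivation ℂ (RatFun N) (RatFun N)) where
  X : Matrix (Fin N) (Fin N) (RatFun N)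
  G : Matrix (Fin N) (Fin N) (RatFun N)
  W : Matrix (Fin N) (Fin N) (RatFun N)
  L : Matrix (Fin N) (Fin N) (RatFun N)
  U : Matrix (Fin N) (Fin N) (RatFun N)
  map_matA : (matA N).map D = X * matA N + matA N * X.transpose
  map_matB : (matB N).map D = G * matB N + matB N * W
  -- The derivative of `S B = 𝔸ᵀ`, with `L S + S U` in place of the derivative of `S`; multiplying
  -- by `B` avoids differentiating an inverse.
  compat : (L * matS N + matS N * U) * matB N + matS N * (G * matB N + matB N * W) =
    X * (matA N).transpose + (matA N).transpose * X.transpose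
  G_lower : ∀ i j, i < j → G i j = 0
  W_lower : ∀ i j, i < j → W i j = 0
  L_lower : ∀ i j, i < j → L i j = 0
  U_upper : ∀ i j, j < i → U i j = 0
  W_diag : ∀ i, W i i = -L i i
  U_diag : ∀ i, U i i = G i i
  trace_X : X.trace = G.trace

namespace TriangularAction

variable {D : Derivation ℂ (RatFun N) (RatFun N)} (a : TriangularAction D)
include a

/-- Differentiate `S B = 𝔸ᵀ`, compare with `compat`, and cancel the invertible `B`. -/
theorem map_matS : (matS N).map D = a.L * matS N + matS N * a.U := by
  have h := congrArg (fun M => M.map D) (matS_mul_matB (N := N))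
  simp only [map_derivation_mul, Matrix.transpose_map] at h
  rw [a.map_matA, Matrix.transpose_add, Matrix.transpose_mul, Matrix.transpose_mul,
    Matrix.transpose_transpose, add_comm (_ * _ : Matrix (Fin N) (Fin N) (RatFun N)) (a.X * _),
    ← a.compat, a.map_matB] at h
  have h' := add_right_cancel h
  have hu : IsUnit (matB N) :=
    (Matrix.isUnit_iff_isUnit_det _).mpr (isUnit_iff_ne_zero.mpr det_matB_ne_zero)
  exact hu.mul_right_cancel h'

theorem upperLeftMinor_matS (q : ℕ) (hq : q ≤ N) :
    D (upperLeftMinor (matS N) q hq) =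
      (∑ i : Fin q, a.L (Fin.castLE hq i) (Fin.castLE hq i) +
        ∑ i : Fin q, a.U (Fin.castLE hq i) (Fin.castLE hq i)) *
      upperLeftMinor (matS N) q hq := by
  have key : ∀ (i : Fin q) (k : Fin N), k ∉ Set.range (Fin.castLE hq) → Fin.castLE hq i < k := by
    intro i k hk
    by_contra h
    exact hk ⟨⟨k, by have := Fin.le_def.mp (not_lt.mp h); simp at this; omega⟩, by ext; simp⟩
  exact derivation_det_submatrix D _ _ _ a.map_matS _ _ (Fin.castLE_injective hq)
    (Fin.castLE_injective hq) (fun i k hk => a.L_lower _ _ (key i k hk))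
    fun i k hk => a.U_upper _ _ (key i k hk)

/-- Lower triangular factors feed the first rows only from the first rows, and the last columns only
from the last columns. -/
theorem upperRightMinor_matB (q : ℕ) (hq : q ≤ N) :
    D (upperRightMinor (matB N) q hq) =
      (∑ i : Fin q, a.G (Fin.castLE hq i) (Fin.castLE hq i) +
        ∑ i : Fin q, a.W ⟨N - q + i, by omega⟩ ⟨N - q + i, by omega⟩) *
      upperRightMinor (matB N) q hq := by
  refine derivation_det_submatrix D _ _ _ a.map_matB (Fin.castLE hq)
    (fun i : Fin q => (⟨N - q + i, by omega⟩ : Fin N)) (Fin.castLE_injective hq)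
    (fun i j h => ?_) (fun i k hk => a.G_lower _ _ ?_) fun j k hk => a.W_lower _ _ ?_
  · simp only [Fin.mk.injEq] at h
    ext
    omega
  · by_contra h
    exact hk ⟨⟨k, by have := Fin.le_def.mp (not_lt.mp h); simp at this; omega⟩, by ext; simp⟩
  · by_contra h
    have := Fin.le_def.mp (not_lt.mp h)
    simp only at this
    exact hk ⟨⟨k - (N - q), by omega⟩, by ext; simp only; omega⟩

theorem det_matB : D (matB N).det = (a.G.trace + a.W.trace) * (matB N).det :=
  derivation_det D _ _ _ a.map_matB

theorem det_matA : D (matA N).det = (a.X.trace + a.X.trace) * (matA N).det := by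
  rw [derivation_det D _ _ _ a.map_matA, Matrix.trace_transpose]

end TriangularAction

theorem sum_head_add_sum_tail {M : Type*} [AddCommMonoid M] (f : Fin N → M) {p q : ℕ}
    (h : p + q = N) :
    ∑ i : Fin p, f (Fin.castLE (by omega) i) + ∑ j : Fin q, f ⟨N - q + j, by omega⟩ =
      ∑ i, f i := by
  subst h
  rw [Fin.sum_univ_add]
  congr 1
  refine Finset.sum_congr rfl fun j _ => congrArg f ?_
  ext
  simp

theorem TriangularAction.casimirX_eq_zero {D : Derivation ℂ (RatFun N) (RatFun N)}
    (a : TriangularAction D) (p : Fin (N / 2)) : D (casimirX p) = 0 := by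
  have hp := p.2
  have h1 : (p : ℕ) + 1 ≤ N := by omega
  have h := derivation_mul_eigen D (derivation_div_eigen D
    (derivation_mul_eigen D (a.upperLeftMinor_matS (p + 1) h1)
      (a.upperLeftMinor_matS (N - (p + 1)) (by omega)))
    (derivation_mul_eigen D (a.upperRightMinor_matB (N - (p + 1)) (by omega))
      (a.upperRightMinor_matB (p + 1) h1)))
    (derivation_div_eigen D (derivation_mul_eigen D a.det_matB a.det_matB) a.det_matA)
  rw [← pow_two] at h
  rw [casimirX, h]
  refine mul_eq_zero_of_left ?_ _
  have e1 := sum_head_add_sum_tail (fun i => a.L i i) (Nat.add_sub_cancel' h1)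
  have e2 := sum_head_add_sum_tail (fun i => a.L i i) (Nat.sub_add_cancel h1)
  have e3 := a.trace_X
  have e4 : a.W.trace = -∑ i, a.L i i := by
    simp [Matrix.trace, a.W_diag]
  simp only [a.U_diag, a.W_diag, e3, e4, Finset.sum_neg_distrib]
  linear_combination e1 + e2

/-- The triangular action of the Hamiltonian vector field of an entry of `𝔸`. -/
def triangularActionInl (k l : Fin N) : TriangularAction (hamiltonian (Sum.inl (k, l))) where
  X := Matrix.of fun i m => (if m = k then 2 * theta i k * matA N i l else 0) -
      (if m = l then 2 * theta l i * matA N k i else 0)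
  G := 0
  W := Matrix.of fun i m => -(if i = k then 2 * theta k m * matA N m l else 0) -
      (if i = l then 2 * theta l m * matA N k m else 0)
  -- `L` arises from `X` by replacing `-θ(l, i)` with `θ(i, l) = 1 - θ(l, i)`, which makes it lower
  -- triangular.
  L := Matrix.of fun i m => (if m = k then 2 * theta i k * matA N i l else 0) +
      (if m = l then 2 * theta i l * matA N k i else 0)
  U := 0
  map_matA := hamiltonian_inl_matA k l _ fun _ _ => rfl
  map_matB := by
    ext i j
    simp only [Matrix.map_apply, Matrix.add_apply, Matrix.mul_apply, Matrix.of_apply,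
      Matrix.zero_apply]
    rw [matB, Matrix.of_apply, hamiltonian_coord, coordBracket, tensorBA_apply, matB]
    simp [mul_sub]
    ring
  compat := by
    rw [Matrix.mul_zero, Matrix.zero_mul, zero_add, add_zero, Matrix.mul_assoc _ (matS N),
      ← Matrix.mul_assoc (matS N), matS_mul_matB]
    ext i j
    have h := theta_add_theta i l
    have h' := theta_add_theta j k
    simp only [Matrix.add_apply, Matrix.mul_apply, Matrix.of_apply, Matrix.transpose_apply]
    simp [mul_sub, sub_mul, add_mul, Finset.sum_sub_distrib, Finset.sum_add_distrib]
    -- The corrections `(L - X)𝔸ᵀ` and `𝔸ᵀ(Xᵀ - W)` are the same rank-one matrix.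
    linear_combination (2 * matA N k i * matA N j l) * h - (2 * matA N k i * matA N j l) * h'
  G_lower _ _ _ := rfl
  U_upper _ _ _ := rfl
  W_lower i j h := by
    have h1 : i = k → theta k j = 0 := by rintro rfl; exact theta_of_lt h
    have h2 : i = l → theta l j = 0 := by rintro rfl; exact theta_of_lt h
    simp +contextual [h1, h2]
  L_lower i j h := by
    have h1 : j = k → theta i k = 0 := by rintro rfl; exact theta_of_lt h
    have h2 : j = l → theta i l = 0 := by rintro rfl; exact theta_of_lt h
    simp +contextual [h1, h2]
  W_diag i := by
    simp only [Matrix.of_apply]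
    split_ifs <;> subst_vars <;> ring
  U_diag _ := rfl
  trace_X := by
    simp [Matrix.trace, Finset.sum_sub_distrib, two_mul_theta_self]

/-- The triangular action of the Hamiltonian vector field of an entry of `B`. -/
def triangularActionInr (k l : Fin N) : TriangularAction (hamiltonian (Sum.inr (k, l))) where
  X := Matrix.of fun i m => if m = l then 2 * theta i l * matB N k i else 0
  G := Matrix.of fun i m => if m = k then 2 * theta i k * matB N i l else 0
  W := Matrix.of fun i m => -(if i = l then 2 * theta l m * matB N k m else 0)
  L := Matrix.of fun i m => if m = l then 2 * theta i l * matB N k i else 0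
  U := Matrix.of fun i m => if m = k then 2 * theta k i * matB N i l else 0
  map_matA := hamiltonian_inr_matA k l _ fun _ _ => rfl
  map_matB := by
    ext i j
    simp only [Matrix.map_apply, Matrix.add_apply, Matrix.mul_apply, Matrix.of_apply]
    rw [matB, Matrix.of_apply, hamiltonian_coord, coordBracket, tensorBB_apply, matB]
    simp
    ring
  compat := by
    set X : Matrix (Fin N) (Fin N) (RatFun N) :=
      Matrix.of fun i m => if m = l then 2 * theta i l * matB N k i else 0 with hX
    set G : Matrix (Fin N) (Fin N) (RatFun N) :=
      Matrix.of fun i m => if m = k then 2 * theta i k * matB N i l else 0 with hG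
    set W : Matrix (Fin N) (Fin N) (RatFun N) :=
      Matrix.of fun i m => -(if i = l then 2 * theta l m * matB N k m else 0) with hW
    set U : Matrix (Fin N) (Fin N) (RatFun N) :=
      Matrix.of fun i m => if m = k then 2 * theta k i * matB N i l else 0 with hU
    -- Here `L = X`, so only the right-hand factor needs care: `U` and `G` add up to a single column
    -- without `θ`, offset by the rank-one difference between `W` and `Xᵀ`.
    have h : (U + G) * matB N + matB N * W = matB N * X.transpose := by
      ext i j
      have h1 := theta_add_theta i k
      have h2 := theta_add_theta j l
      simp only [Matrix.add_apply, Matrix.mul_apply, hX, hG, hW, hU, Matrix.of_apply,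
        Matrix.transpose_apply]
      simp [add_mul, Finset.sum_add_distrib]
      linear_combination (2 * matB N i l * matB N k j) * (h1 - h2)
    rw [← matS_mul_matB, Matrix.mul_assoc (matS N), ← h]
    noncomm_ring
  G_lower i j h := by
    have h1 : j = k → theta i k = 0 := by rintro rfl; exact theta_of_lt h
    simp +contextual [h1]
  U_upper i j h := by
    have h1 : j = k → theta k i = 0 := by rintro rfl; exact theta_of_lt h
    simp +contextual [h1]
  W_lower i j h := by
    have h1 : i = l → theta l j = 0 := by rintro rfl; exact theta_of_lt h
    simp +contextual [h1]
  L_lower i j h := by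
    have h1 : j = l → theta i l = 0 := by rintro rfl; exact theta_of_lt h
    simp +contextual [h1]
  W_diag i := by
    by_cases h1 : i = l <;> simp_all
  U_diag i := by
    by_cases h1 : i = k <;> simp_all
  trace_X := by
    simp [Matrix.trace, two_mul_theta_self]

theorem isCasimir_casimirX (p : Fin (N / 2)) : IsCasimir (casimirX (N := N) p) := by
  refine isCasimir_of_hamiltonian_eq_zero fun y => ?_
  rcases y with ⟨k, l⟩ | ⟨k, l⟩
  · exact (triangularActionInl k l).casimirX_eq_zero p
  · exact (triangularActionInr k l).casimirX_eq_zero p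

/-! ### The expansion of `det (λ A + λ⁻¹ Aᵀ)` -/

section Laurent

open LaurentPolynomial

variable {R : Type*} [CommRing R] {N : ℕ}

/-- The polynomial `det (λ A + Aᵀ)` in `λ`. -/
def pencilPoly (A : Matrix (Fin N) (Fin N) R) : Polynomial R :=
  ((Polynomial.X : Polynomial R) • A.map Polynomial.C + A.transpose.map Polynomial.C).det

theorem natDegree_pencilPoly_lt (A : Matrix (Fin N) (Fin N) R) :
    (pencilPoly A).natDegree < N + 1 := by
  have h := Polynomial.natDegree_det_X_add_C_le A A.transpose
  rw [Fintype.card_fin] at h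
  exact Nat.lt_succ_of_le h

theorem map_pencilPoly {S : Type*} [CommRing S] (f : R →+* S) (A : Matrix (Fin N) (Fin N) R) :
    (pencilPoly A).map f = pencilPoly (f.mapMatrix A) := by
  rw [pencilPoly, ← Polynomial.coe_mapRingHom, RingHom.map_det, pencilPoly]
  congr 1
  refine Matrix.ext fun i j => ?_
  simp

theorem coeff_pencilPoly_zero (A : Matrix (Fin N) (Fin N) R) : (pencilPoly A).coeff 0 = A.det := by
  rw [pencilPoly, Polynomial.coeff_det_X_add_C_zero, Matrix.det_transpose]

theorem coeff_pencilPoly_self (A : Matrix (Fin N) (Fin N) R) : (pencilPoly A).coeff N = A.det := by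
  have h := Polynomial.coeff_det_X_add_C_card A A.transpose
  rwa [Fintype.card_fin] at h

theorem eval_pencilPoly (A : Matrix (Fin N) (Fin N) R) (r : R) :
    (pencilPoly A).eval r = (r • A + A.transpose).det := by
  rw [pencilPoly, ← Polynomial.coe_evalRingHom, RingHom.map_det]
  congr 1
  ext i j
  simp
  exact mul_comm _ _

/-- `det (λ A + λ⁻¹ Aᵀ)` as a Laurent polynomial in `λ`. -/
def pencilLaurent (A : Matrix (Fin N) (Fin N) R) : LaurentPolynomial R :=
  ((T 1 : LaurentPolynomial R) • A.map (C : R →+* LaurentPolynomial R) +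
    (T (-1) : LaurentPolynomial R) • A.transpose.map (C : R →+* LaurentPolynomial R)).det

/-- Pulling `λ⁻¹` out of every row leaves the ordinary pencil evaluated at `λ²`. -/
theorem pencilLaurent_eq_sum (A : Matrix (Fin N) (Fin N) R) :
    pencilLaurent A =
      ∑ k ∈ Finset.range (N + 1), C ((pencilPoly A).coeff k) * T (2 * (k : ℤ) - N) := by
  have h : ((T 1 : LaurentPolynomial R) • A.map (C : R →+* LaurentPolynomial R) +
      (T (-1) : LaurentPolynomial R) • A.transpose.map (C : R →+* LaurentPolynomial R)) =
      (T (-1) : LaurentPolynomial R) • (Polynomial.eval₂RingHom C (T 2)).mapMatrix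
        ((Polynomial.X : Polynomial R) • A.map Polynomial.C + A.transpose.map Polynomial.C) := by
    refine Matrix.ext fun i j => ?_
    simp [mul_add, ← mul_assoc]
  rw [pencilLaurent, h, Matrix.det_smul, ← RingHom.map_det, ← pencilPoly,
    Polynomial.coe_eval₂RingHom, Polynomial.eval₂_eq_sum_range' _ (natDegree_pencilPoly_lt A),
    Finset.mul_sum, Fintype.card_fin]
  refine Finset.sum_congr rfl fun k _ => ?_
  rw [T_pow, T_pow, mul_left_comm, ← T_add]
  congr 2
  ring

theorem coeff_sum_C_mul_T (c : ℕ → R) {k : ℕ} (hk : k ≤ N) :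
    (∑ k ∈ Finset.range (N + 1), C (c k) * T (2 * (k : ℤ) - N)).coeff (2 * (k : ℤ) - N) = c k := by
  rw [AddMonoidAlgebra.coeff_sum, Finset.sum_apply', Finset.sum_eq_single k]
  · simp [← single_eq_C_mul_T]
  · intro b _ hb
    rw [← single_eq_C_mul_T, AddMonoidAlgebra.coeff_single, Finsupp.single_apply, if_neg]
    omega
  · intro h
    exact absurd (Finset.mem_range.mpr (Nat.lt_succ_of_le hk)) h

/-- Exchanging `λ` and `λ⁻¹` transposes the pencil; this is the source of the palindromic symmetry.
-/
theorem invert_pencilLaurent (A : Matrix (Fin N) (Fin N) R) :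
    invert (pencilLaurent A) = pencilLaurent A := by
  rw [pencilLaurent, AlgEquiv.map_det, ← Matrix.det_transpose]
  congr 1
  refine Matrix.ext fun i j => ?_
  simp [add_comm]

theorem coeff_pencilPoly_symm (A : Matrix (Fin N) (Fin N) R) {k : ℕ} (hk : k ≤ N) :
    (pencilPoly A).coeff (N - k) = (pencilPoly A).coeff k := by
  rw [← coeff_sum_C_mul_T (N := N) (pencilPoly A).coeff hk,
    ← coeff_sum_C_mul_T (N := N) (pencilPoly A).coeff (Nat.sub_le N k), ← pencilLaurent_eq_sum,
    ← invert_pencilLaurent, invert_apply, invert_pencilLaurent]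
  congr 1
  push_cast [Nat.cast_sub hk]
  ring

/-- Pairing the terms `k` and `N - k` of a sum over `0 ≤ k ≤ N`. -/
theorem sum_range_fold {M : Type*} [AddCommMonoid M] : ∀ (N : ℕ) (_ : 1 ≤ N) (f : ℕ → M),
    ∑ k ∈ Finset.range (N + 1), f k = f 0 + f N +
      ∑ p ∈ Finset.range (N / 2),
        if 2 * (p + 1) = N then f (p + 1) else f (p + 1) + f (N - (p + 1))
  | 0, h, _ => absurd h (by norm_num)
  | 1, _, f => by simp [Finset.sum_range_succ]
  -- A separate base case: stripping both ends would land on `0`, where the formula counts the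
  -- single term twice.
  | 2, _, f => by
    simp [Finset.sum_range_succ]
    abel
  | N + 3, _, f => by
    rw [Finset.sum_range_succ, Finset.sum_range_succ',
      sum_range_fold (N + 1) (by omega) fun k => f (k + 1)]
    have h : (N + 3) / 2 = (N + 1) / 2 + 1 := by omega
    rw [h, Finset.sum_range_succ' _ ((N + 1) / 2)]
    have h0 : ¬2 * (0 + 1) = N + 3 := by omega
    rw [if_neg h0]
    have h1 : ∀ p ∈ Finset.range ((N + 1) / 2),
        (if 2 * (p + 1) = N + 1 then f (p + 1 + 1) else f (p + 1 + 1) + f (N + 1 - (p + 1) + 1)) =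
          if 2 * (p + 1 + 1) = N + 3 then f (p + 1 + 1)
            else f (p + 1 + 1) + f (N + 3 - (p + 1 + 1)) := by
      intro p hp
      rw [Finset.mem_range] at hp
      have e : N + 1 - (p + 1) + 1 = N + 3 - (p + 1 + 1) := by omega
      rw [e]
      exact if_congr (by omega) rfl rfl
    rw [Finset.sum_congr rfl h1]
    have e : N + 3 - (0 + 1) = N + 1 + 1 := by omega
    rw [e]
    abel

theorem charLaurent_eq_sum :
    charLaurent N = ∑ k ∈ Finset.range (N + 1),
      C ((pencilPoly (matA N)).coeff k / (matA N).det) * T (2 * (k : ℤ) - N) := by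
  change pencilLaurent (matA N) * C ((matA N).det)⁻¹ = _
  rw [pencilLaurent_eq_sum, Finset.sum_mul]
  refine Finset.sum_congr rfl fun k _ => ?_
  rw [div_eq_mul_inv, map_mul]
  ring

theorem casimirY_eq (p : Fin (N / 2)) :
    casimirY p = (pencilPoly (matA N)).coeff ((p : ℕ) + 1) / (matA N).det /
      (if 2 * ((p : ℕ) + 1) = N then 2 else 1) := by
  have hp : (p : ℕ) + 1 ≤ N := by omega
  rw [casimirY, ← coeff_pencilPoly_symm _ hp, charLaurent_eq_sum]
  congr 1
  rw [← coeff_sum_C_mul_T (N := N) (fun k => (pencilPoly (matA N)).coeff k / (matA N).det)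
    (Nat.sub_le N (p + 1))]
  congr 1
  push_cast [Nat.cast_sub hp]
  ring

theorem charLaurent_expansion (hN : 1 ≤ N) :
    charLaurent N =
      (T (N : ℤ) + T (-(N : ℤ))) +
        ∑ p : Fin (N / 2),
          (T ((N : ℤ) - 2 * ((p : ℤ) + 1)) + T (2 * ((p : ℤ) + 1) - (N : ℤ))) *
            C (casimirY p) := by
  have h0 : (matA N).det ≠ 0 := det_matA_ne_zero
  rw [charLaurent_eq_sum, sum_range_fold N hN, coeff_pencilPoly_zero, coeff_pencilPoly_self,
    div_self h0, map_one, one_mul, one_mul, Finset.sum_range]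
  congr 1
  · rw [add_comm]
    congr 2
    · ring
    · simp
  refine Finset.sum_congr rfl fun p _ => ?_
  have hp : (p : ℕ) + 1 ≤ N := by omega
  rw [casimirY_eq, coeff_pencilPoly_symm _ hp, Nat.cast_sub hp]
  push_cast
  split_ifs with h
  -- In the middle term both powers of `λ` are `1`, which the halving in `casimirY` compensates.
  · have h' : (N : ℤ) = 2 * ((p : ℤ) + 1) := by exact_mod_cast h.symm
    have h2 : (C (2 : RatFun N) : LaurentPolynomial (RatFun N)) = 2 := map_ofNat _ 2
    have h3 : C ((pencilPoly (matA N)).coeff ((p : ℕ) + 1) / (matA N).det) =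
        (2 : LaurentPolynomial (RatFun N)) *
          C ((pencilPoly (matA N)).coeff ((p : ℕ) + 1) / (matA N).det / 2) := by
      rw [← h2, ← map_mul]
      congr 1
      field_simp
    rw [h3, h', sub_self, T_zero]
    ring
  · rw [div_one, ← mul_add, mul_comm, add_comm]
    congr 3
    ring

end Laurent

/-! ### The functions `Y_p` are Casimir functions -/

section

variable {N : ℕ} {R K : Type*} [CommRing R] [Field K] [CharZero K] [Algebra R K]

/-- For each natural `n`, a constant of `D`, the matrix `nA + Aᵀ` moves by the same congruence as
`A`. The resulting determinant identity is polynomial in `n` and holds at infinitely many points,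
hence for each coefficient. -/
theorem derivation_coeff_pencilPoly (D : Derivation R K K) (A X : Matrix (Fin N) (Fin N) K)
    (h : A.map D = X * A + A * X.transpose) (k : ℕ) :
    D ((pencilPoly A).coeff k) = (X.trace + X.trace) * (pencilPoly A).coeff k := by
  set Q : Polynomial K := ∑ k ∈ Finset.range (N + 1), Polynomial.monomial k
    (D ((pencilPoly A).coeff k) - (X.trace + X.trace) * (pencilPoly A).coeff k) with hQ
  have hQ0 : Q = 0 := by
    refine Polynomial.eq_zero_of_infinite_isRoot Q
      ((Set.infinite_range_of_injective (Nat.cast_injective (R := K))).mono ?_)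
    rintro _ ⟨n, rfl⟩
    have h1 : ((n : K) • A + A.transpose).map D =
        X * ((n : K) • A + A.transpose) + ((n : K) • A + A.transpose) * X.transpose := by
      have h2 : ((n : K) • A + A.transpose).map D = (n : K) • A.map D + (A.map D).transpose := by
        ext i j
        simp
      rw [h2, h]
      simp [mul_add, add_mul]
      abel
    have h3 := derivation_det D _ _ _ h1
    rw [Matrix.trace_transpose, ← eval_pencilPoly,
      Polynomial.eval_eq_sum_range' (natDegree_pencilPoly_lt A), map_sum, Finset.mul_sum] at h3
    simp only [Set.mem_ofPred_eq, Polynomial.IsRoot, hQ, Polynomial.eval_finsetSum,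
      Polynomial.eval_monomial]
    rw [← sub_eq_zero, ← Finset.sum_sub_distrib] at h3
    rw [← h3]
    refine Finset.sum_congr rfl fun k _ => ?_
    rw [Derivation.leibniz, Derivation.leibniz_pow, Derivation.map_natCast]
    simp
    ring
  by_cases hk : k < N + 1
  · have h1 := congrArg (fun q => Polynomial.coeff q k) hQ0
    simp only [hQ, Polynomial.finsetSum_coeff, Polynomial.coeff_monomial, Polynomial.coeff_zero,
      Finset.sum_ite_eq', Finset.mem_range, if_pos hk] at h1
    exact sub_eq_zero.mp h1
  · rw [Polynomial.coeff_eq_zero_of_natDegree_lt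
      ((natDegree_pencilPoly_lt A).trans_le (not_lt.mp hk)), map_zero, mul_zero]

end

theorem isCasimir_casimirY {N : ℕ} (p : Fin (N / 2)) : IsCasimir (casimirY (N := N) p) := by
  refine isCasimir_of_hamiltonian_eq_zero fun y => ?_
  obtain ⟨X, hX⟩ := exists_hamiltonian_matA (N := N) y
  have hdet : hamiltonian y (matA N).det = (X.trace + X.trace) * (matA N).det := by
    rw [derivation_det _ _ _ _ hX, Matrix.trace_transpose]
  have hc : hamiltonian y (if 2 * ((p : ℕ) + 1) = N then 2 else 1) =
      0 * (if 2 * ((p : ℕ) + 1) = N then 2 else 1 : RatFun N) := by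
    rw [zero_mul]
    split_ifs
    · exact Derivation.map_natCast _ 2
    · simp
  rw [casimirY_eq, derivation_div_eigen _ (derivation_div_eigen _
    (derivation_coeff_pencilPoly _ _ _ hX _) hdet) hc]
  simp

/-! ### Values of rational functions at a point -/

/-- The pairs `(f, c)` where the rational function `f` is regular at the point `v` with value
`c`. -/
def regularValues (v : Coord N → ℂ) : Subalgebra ℂ (RatFun N × ℂ) where
  carrier := {x | ∃ p q : PolyFun N, MvPolynomial.eval v q ≠ 0 ∧
    x.1 = algebraMap (PolyFun N) (RatFun N) p / algebraMap (PolyFun N) (RatFun N) q ∧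
    x.2 = MvPolynomial.eval v p / MvPolynomial.eval v q}
  algebraMap_mem' c := by
    refine ⟨MvPolynomial.C c, 1, by simp, ?_, by simp⟩
    rw [map_one, div_one, ← MvPolynomial.algebraMap_eq, ← IsScalarTower.algebraMap_apply]
    rfl
  mul_mem' := by
    rintro ⟨_, _⟩ ⟨_, _⟩ ⟨p, q, hq, rfl, rfl⟩ ⟨p', q', hq', rfl, rfl⟩
    exact ⟨p * p', q * q', by simp [hq, hq'], by simp [div_mul_div_comm],
      by simp [div_mul_div_comm]⟩
  add_mem' := by
    rintro ⟨_, _⟩ ⟨_, _⟩ ⟨p, q, hq, rfl, rfl⟩ ⟨p', q', hq', rfl, rfl⟩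
    have h : q ≠ 0 := fun h => hq (by rw [h, map_zero])
    have h' : q' ≠ 0 := fun h => hq' (by rw [h, map_zero])
    exact ⟨p * q' + q * p', q * q', by simp [hq, hq'],
      by simp [div_add_div _ _ (algebraMap_ne_zero h) (algebraMap_ne_zero h')],
      by simp [div_add_div _ _ hq hq']⟩

/-- The rational function `f` is regular at `v` with value `c`. -/
def HasValue (v : Coord N → ℂ) (f : RatFun N) (c : ℂ) : Prop := (f, c) ∈ regularValues v

namespace HasValue

variable {v : Coord N → ℂ}

/-- The only uniqueness of values needed: it turns an algebraic relation into a vanishing polynomial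
value. -/
theorem eq_zero {c : ℂ} (h : HasValue v 0 c) : c = 0 := by
  obtain ⟨p, q, hq, h1, h2⟩ := h
  have hq' : q ≠ 0 := fun h => hq (by rw [h, map_zero])
  have hp : algebraMap (PolyFun N) (RatFun N) p = 0 := by
    rcases div_eq_zero_iff.mp h1.symm with h | h
    · exact h
    · exact absurd h (algebraMap_ne_zero hq')
  have hp' : p = 0 := by
    by_contra h
    exact algebraMap_ne_zero h hp
  simpa [hp'] using h2

theorem coord (x : Coord N) : HasValue v (coord x) (v x) :=
  ⟨MvPolynomial.X x, 1, by simp, by simp [BilinearPoisson.coord], by simp⟩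

theorem const (c : ℂ) : HasValue v (algebraMap ℂ (RatFun N) c) c :=
  (regularValues v).algebraMap_mem c

theorem mul {f g : RatFun N} {c d : ℂ} (hf : HasValue v f c) (hg : HasValue v g d) :
    HasValue v (f * g) (c * d) :=
  (regularValues v).mul_mem hf hg

theorem inv {f : RatFun N} {c : ℂ} (hf : HasValue v f c) (hc : c ≠ 0) :
    HasValue v f⁻¹ c⁻¹ := by
  obtain ⟨p, q, hq, h1, h2⟩ := hf
  simp only at h1 h2
  refine ⟨q, p, fun h => hc (by rw [h2, h, zero_div]), ?_, ?_⟩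
  · simp [h1]
  · simp [h2]

theorem div {f g : RatFun N} {c d : ℂ} (hf : HasValue v f c) (hg : HasValue v g d) (hd : d ≠ 0) :
    HasValue v (f / g) (c / d) := by
  rw [div_eq_mul_inv, div_eq_mul_inv]
  exact hf.mul (hg.inv hd)

section Matrix

variable {n : Type*} [Fintype n] [DecidableEq n] {M : Matrix n n (RatFun N)} {m : Matrix n n ℂ}

/-- A matrix of pairs of rational functions and values. -/
def liftMatrix (h : ∀ i j, HasValue v (M i j) (m i j)) : Matrix n n (regularValues v) :=
  Matrix.of fun i j => ⟨(M i j, m i j), h i j⟩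

variable (v) in
/-- The rational function of a pair. -/
def toFun : regularValues v →+* RatFun N :=
  (RingHom.fst (RatFun N) ℂ).comp (regularValues v).subtype

variable (v) in
/-- The value of a pair. -/
def toVal : regularValues v →+* ℂ :=
  (RingHom.snd (RatFun N) ℂ).comp (regularValues v).subtype

theorem of_pair (x : regularValues v) : HasValue v (toFun v x) (toVal v x) := x.2

theorem mapMatrix_toFun (h : ∀ i j, HasValue v (M i j) (m i j)) :
    (toFun v).mapMatrix (liftMatrix h) = M := rfl

theorem mapMatrix_toVal (h : ∀ i j, HasValue v (M i j) (m i j)) :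
    (toVal v).mapMatrix (liftMatrix h) = m := rfl

/-- The determinant is formed inside the subalgebra of pairs and then projected to both components;
the other matrix operations are treated likewise. -/
theorem det (h : ∀ i j, HasValue v (M i j) (m i j)) : HasValue v M.det m.det := by
  have := of_pair (liftMatrix h).det
  rwa [RingHom.map_det, RingHom.map_det, mapMatrix_toFun, mapMatrix_toVal] at this

theorem adjugate (h : ∀ i j, HasValue v (M i j) (m i j)) (i j : n) :
    HasValue v (M.adjugate i j) (m.adjugate i j) := by
  have := of_pair ((liftMatrix h).adjugate i j)
  have e1 := congrFun (congrFun ((toFun v).map_adjugate (liftMatrix h)) i) j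
  have e2 := congrFun (congrFun ((toVal v).map_adjugate (liftMatrix h)) i) j
  rw [mapMatrix_toFun] at e1
  rw [mapMatrix_toVal] at e2
  rw [← e1, ← e2]
  exact this

theorem matrix_inv (h : ∀ i j, HasValue v (M i j) (m i j)) (hm : m.det ≠ 0) (i j : n) :
    HasValue v (M⁻¹ i j) (m⁻¹ i j) := by
  rw [Matrix.inv_def, Matrix.inv_def, Matrix.smul_apply, Matrix.smul_apply,
    Ring.inverse_eq_inv', Ring.inverse_eq_inv', smul_eq_mul, smul_eq_mul]
  exact ((det h).inv hm).mul (adjugate h i j)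

theorem matrix_mul {M' : Matrix n n (RatFun N)} {m' : Matrix n n ℂ}
    (h : ∀ i j, HasValue v (M i j) (m i j)) (h' : ∀ i j, HasValue v (M' i j) (m' i j)) (i j : n) :
    HasValue v ((M * M') i j) ((m * m') i j) := by
  have := of_pair ((liftMatrix h * liftMatrix h') i j)
  have e1 := congrFun (congrFun ((toFun v).mapMatrix.map_mul (liftMatrix h) (liftMatrix h')) i) j
  have e2 := congrFun (congrFun ((toVal v).mapMatrix.map_mul (liftMatrix h) (liftMatrix h')) i) j
  rw [mapMatrix_toFun, mapMatrix_toFun] at e1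
  rw [mapMatrix_toVal, mapMatrix_toVal] at e2
  rw [← e1, ← e2]
  exact this

theorem coeff_pencilPoly {r : ℕ} {M : Matrix (Fin r) (Fin r) (RatFun N)}
    {m : Matrix (Fin r) (Fin r) ℂ} (h : ∀ i j, HasValue v (M i j) (m i j)) (k : ℕ) :
    HasValue v ((pencilPoly M).coeff k) ((pencilPoly m).coeff k) := by
  have := of_pair ((pencilPoly (liftMatrix h)).coeff k)
  rwa [← Polynomial.coeff_map, ← Polynomial.coeff_map, map_pencilPoly, map_pencilPoly,
    mapMatrix_toFun, mapMatrix_toVal] at this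

end Matrix

theorem aeval {ι : Type*} {f : ι → RatFun N} {z : ι → ℂ} (h : ∀ i, HasValue v (f i) (z i))
    (P : MvPolynomial ι ℂ) : HasValue v (MvPolynomial.aeval f P) (MvPolynomial.eval z P) := by
  induction P using MvPolynomial.induction_on with
  | C c => simpa using const c
  | add p q hp hq =>
    rw [map_add, map_add]
    exact (regularValues v).add_mem hp hq
  | mul_X p i hp =>
    rw [map_mul, map_mul, MvPolynomial.aeval_X, MvPolynomial.eval_X]
    exact hp.mul (h i)

end HasValue

/-- Rational functions which take all values in a product of infinite sets are algebraically
independent. -/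
theorem algebraicIndependent_of_hasValue {ι : Type*} (f : ι → RatFun N) (s : ι → Set ℂ)
    (hs : ∀ i, (s i).Infinite)
    (h : ∀ z ∈ Set.pi Set.univ s, ∃ v, ∀ i, HasValue v (f i) (z i)) :
    AlgebraicIndependent ℂ f := by
  rw [algebraicIndependent_iff]
  intro P hP
  refine MvPolynomial.funext_set s hs fun z hz => ?_
  obtain ⟨v, hv⟩ := h z hz
  have := HasValue.aeval hv P
  rw [hP] at this
  rw [this.eq_zero, map_zero]

/-- The point with coordinates the entries of two complex matrices. -/
def matrixPoint (A B : Matrix (Fin N) (Fin N) ℂ) : Coord N → ℂ :=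
  Sum.elim (fun ij => A ij.1 ij.2) fun ij => B ij.1 ij.2

theorem hasValue_matA (A B : Matrix (Fin N) (Fin N) ℂ) (i j : Fin N) :
    HasValue (matrixPoint A B) (matA N i j) (A i j) :=
  HasValue.coord (v := matrixPoint A B) (Sum.inl (i, j))

theorem hasValue_matB (A B : Matrix (Fin N) (Fin N) ℂ) (i j : Fin N) :
    HasValue (matrixPoint A B) (matB N i j) (B i j) :=
  HasValue.coord (v := matrixPoint A B) (Sum.inr (i, j))

theorem hasValue_casimirY (A B : Matrix (Fin N) (Fin N) ℂ) (hA : A.det ≠ 0) (p : Fin (N / 2)) :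
    HasValue (matrixPoint A B) (casimirY p) ((pencilPoly A).coeff ((p : ℕ) + 1) / A.det /
      (if 2 * ((p : ℕ) + 1) = N then 2 else 1)) := by
  rw [casimirY_eq]
  refine ((HasValue.coeff_pencilPoly (hasValue_matA A B) _).div
    (HasValue.det (hasValue_matA A B)) hA).div ?_ (by split_ifs <;> norm_num)
  split_ifs
  · rw [← map_ofNat (algebraMap ℂ (RatFun N)) 2]
    exact HasValue.const 2
  · simpa using HasValue.const (v := matrixPoint A B) 1

theorem hasValue_casimirX (A B S : Matrix (Fin N) (Fin N) ℂ) (hA : A.det ≠ 0) (hB : B.det ≠ 0)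
    (hS : S = A.transpose * B⁻¹) (s b : ℕ → ℂ)
    (hs : ∀ q (hq : q ≤ N), (S.submatrix (Fin.castLE hq) (Fin.castLE hq)).det = s q)
    (hb : ∀ q (hq : q ≤ N), (B.submatrix (Fin.castLE hq)
      fun j : Fin q => (⟨N - q + j, by omega⟩ : Fin N)).det = b q)
    (hb0 : ∀ q, b q ≠ 0) (p : Fin (N / 2)) :
    HasValue (matrixPoint A B) (casimirX p)
      (s (p + 1) * s (N - (p + 1)) / (b (N - (p + 1)) * b (p + 1)) * (B.det ^ 2 / A.det)) := by
  have h1 : (p : ℕ) + 1 ≤ N := by omega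
  have hSv : ∀ i j, HasValue (matrixPoint A B) (matS N i j) (S i j) := by
    rw [hS]
    exact HasValue.matrix_mul (M := (matA N).transpose) (m := A.transpose)
      (fun i j => hasValue_matA A B j i) (HasValue.matrix_inv (hasValue_matB A B) hB)
  have hl : ∀ q (hq : q ≤ N), HasValue (matrixPoint A B) (upperLeftMinor (matS N) q hq) (s q) := by
    intro q hq
    rw [← hs q hq]
    exact HasValue.det fun i j => hSv _ _
  have hr : ∀ q (hq : q ≤ N), HasValue (matrixPoint A B) (upperRightMinor (matB N) q hq) (b q) := by
    intro q hq
    rw [← hb q hq]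
    exact HasValue.det fun i j => hasValue_matB A B _ _
  have hd := HasValue.det (hasValue_matB A B)
  refine (((hl _ h1).mul (hl _ (by omega))).div ((hr _ (by omega)).mul (hr _ h1))
    (mul_ne_zero (hb0 _) (hb0 _))).mul (HasValue.div ?_ (HasValue.det (hasValue_matA A B)) hA)
  rw [pow_two, pow_two]
  exact hd.mul hd

/-! ### Antidiagonal matrices -/

section Antidiagonal

variable {R : Type*} [CommRing R]

/-- The antidiagonal matrix with entry `w i` in row `i`. -/
def antidiagonal {q : ℕ} (w : Fin q → R) : Matrix (Fin q) (Fin q) R :=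
  Matrix.of fun i j => if j = Fin.rev i then w i else 0

/-- The sign of the reversal of `q` letters. -/
def revSign (R : Type*) [CommRing R] (q : ℕ) : R :=
  ((Equiv.Perm.sign (Fin.revPerm : Equiv.Perm (Fin q)) : ℤ) : R)

theorem revSign_ne_zero [Nontrivial R] (q : ℕ) : revSign R q ≠ 0 := by
  rcases Int.units_eq_one_or (Equiv.Perm.sign (Fin.revPerm : Equiv.Perm (Fin q))) with h | h <;>
    simp [revSign, h]

theorem det_antidiagonal {q : ℕ} (w : Fin q → R) :
    (antidiagonal w).det = revSign R q * ∏ i, w i := by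
  have h : antidiagonal w = (Matrix.diagonal w).submatrix id (Fin.revPerm : Equiv.Perm (Fin q)) := by
    ext i j
    simp only [antidiagonal, Matrix.of_apply, Matrix.submatrix_apply, id, Matrix.diagonal_apply,
      Fin.revPerm_apply]
    exact if_congr (by rw [eq_comm, Fin.rev_eq_iff]) rfl rfl
  rw [h, Matrix.det_permute', Matrix.det_diagonal, revSign]

theorem transpose_antidiagonal {q : ℕ} (w : Fin q → R) :
    (antidiagonal w).transpose = antidiagonal fun i => w (Fin.rev i) := by
  ext i j
  simp only [antidiagonal, Matrix.of_apply, Matrix.transpose_apply]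
  by_cases h : j = Fin.rev i
  · simp [h]
  · rw [if_neg h, if_neg]
    rintro rfl
    simp at h

theorem diagonal_mul_antidiagonal {q : ℕ} (s w : Fin q → R) :
    Matrix.diagonal s * antidiagonal w = antidiagonal fun i => s i * w i := by
  ext i j
  simp [antidiagonal, Matrix.diagonal_mul]

/-- Upper-right blocks of antidiagonal matrices are again antidiagonal, so all minors of `B` at the
test points are explicit products. -/
theorem antidiagonal_submatrix {N q : ℕ} (hq : q ≤ N) (w : Fin N → R) :
    (antidiagonal w).submatrix (Fin.castLE hq)
      (fun j : Fin q => (⟨N - q + j, by omega⟩ : Fin N)) =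
      antidiagonal fun i => w (Fin.castLE hq i) := by
  ext i j
  simp only [antidiagonal, Matrix.of_apply, Matrix.submatrix_apply, Fin.ext_iff, Fin.val_rev,
    Fin.val_castLE]
  exact if_congr (by omega) rfl rfl

open LaurentPolynomial in
theorem pencilLaurent_antidiagonal {N : ℕ} (w : Fin N → R) :
    pencilLaurent (antidiagonal w) =
      C (revSign R N) * ∏ i, (T 1 * C (w i) + T (-1) * C (w (Fin.rev i))) := by
  have h : (T 1 : LaurentPolynomial R) • (antidiagonal w).map (C : R →+* LaurentPolynomial R) +
      (T (-1) : LaurentPolynomial R) •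
        (antidiagonal w).transpose.map (C : R →+* LaurentPolynomial R) =
      antidiagonal fun i => T 1 * C (w i) + T (-1) * C (w (Fin.rev i)) := by
    rw [transpose_antidiagonal]
    refine Matrix.ext fun i j => ?_
    simp only [antidiagonal, Matrix.add_apply, Matrix.smul_apply, Matrix.map_apply,
      Matrix.of_apply, smul_eq_mul]
    split_ifs <;> simp
  rw [pencilLaurent, h, det_antidiagonal]
  simp [revSign]

end Antidiagonal

/-- Pairing the factors `k` and `N - 1 - k` of a product over `0 ≤ k < N`. -/
theorem prod_range_fold {M : Type*} [CommMonoid M] : ∀ (N : ℕ) (f : ℕ → M),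
    ∏ k ∈ Finset.range N, f k =
      (∏ p ∈ Finset.range (N / 2), f p * f (N - 1 - p)) * f (N / 2) ^ (N % 2)
  | 0, f => by simp
  | 1, f => by simp
  | N + 2, f => by
    rw [Finset.prod_range_succ, Finset.prod_range_succ', prod_range_fold N fun k => f (k + 1)]
    have h : (N + 2) / 2 = N / 2 + 1 := by omega
    have h' : (N + 2) % 2 = N % 2 := by omega
    rw [h, h', Finset.prod_range_succ' _ (N / 2)]
    have h1 : ∀ p ∈ Finset.range (N / 2),
        f (p + 1) * f (N - 1 - p + 1) = f (p + 1) * f (N + 2 - 1 - (p + 1)) := by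
      intro p hp
      rw [Finset.mem_range] at hp
      congr 2
      omega
    rw [Finset.prod_congr rfl h1]
    have e : N + 2 - 1 - 0 = N + 1 := by omega
    rw [e]
    exact (mul_assoc _ _ _).trans (mul_right_comm _ _ _)

/-! ### Palindromic Laurent polynomials -/

section Palindromic

open LaurentPolynomial

/-- Solutions of the recursion `Q (k + 2) = X * Q (k + 1) - Q k`. -/
def vietaSeq (P₀ P₁ : Polynomial ℂ) : ℕ → Polynomial ℂ
  | 0 => P₀
  | 1 => P₁
  | k + 2 => Polynomial.X * vietaSeq P₀ P₁ (k + 1) - vietaSeq P₀ P₁ k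

/-- The term `X * Q (k + 1)` dominates the recursion. At index `0` only a degree bound is claimed,
because the even case starts from the non-monic constant `2`. -/
theorem vietaSeq_degree (P₀ P₁ : Polynomial ℂ) (h0 : P₀.degree ≤ 0) (h1 : P₁.Monic)
    (h1' : P₁.degree = 1) : ∀ k, (vietaSeq P₀ P₁ k).degree ≤ (k : WithBot ℕ) ∧
      (vietaSeq P₀ P₁ (k + 1)).Monic ∧ (vietaSeq P₀ P₁ (k + 1)).degree = ((k + 1 : ℕ) : WithBot ℕ)
  | 0 => ⟨by simpa [vietaSeq] using h0, by simpa [vietaSeq] using h1, by simpa [vietaSeq] using h1'⟩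
  | k + 1 => by
    obtain ⟨ha, hb, hc⟩ := vietaSeq_degree P₀ P₁ h0 h1 h1' k
    have hd : (Polynomial.X * vietaSeq P₀ P₁ (k + 1)).degree = ((k + 2 : ℕ) : WithBot ℕ) := by
      rw [Polynomial.degree_mul, Polynomial.degree_X, hc, add_comm]
      rfl
    have hlt : (vietaSeq P₀ P₁ k).degree < (Polynomial.X * vietaSeq P₀ P₁ (k + 1)).degree := by
      rw [hd]
      exact lt_of_le_of_lt ha (by exact_mod_cast (by omega : k < k + 2))
    refine ⟨hc.le, ?_, ?_⟩
    · exact (Polynomial.monic_X.mul hb).sub_of_left hlt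
    · change (Polynomial.X * vietaSeq P₀ P₁ (k + 1) - vietaSeq P₀ P₁ k).degree = _
      rw [Polynomial.degree_sub_eq_left_of_degree_lt hlt, hd]

/-- With `X = λ² + λ⁻²` the recursion is the product-to-sum rule for `λ^m + λ^(-m)`. For odd
exponents (`δ = 1`) a factor `λ + λ⁻¹` is split off first. -/
theorem aeval_vietaSeq (P₀ P₁ : Polynomial ℂ) (δ : ℕ)
    (h0 : Polynomial.aeval (T 2 + T (-2) : LaurentPolynomial ℂ) P₀ * (T 1 + T (-1)) ^ δ =
      T (δ : ℤ) + T (-(δ : ℤ)))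
    (h1 : Polynomial.aeval (T 2 + T (-2) : LaurentPolynomial ℂ) P₁ * (T 1 + T (-1)) ^ δ =
      T ((δ : ℤ) + 2) + T (-((δ : ℤ) + 2))) : ∀ k : ℕ,
    Polynomial.aeval (T 2 + T (-2) : LaurentPolynomial ℂ) (vietaSeq P₀ P₁ k) *
      (T 1 + T (-1)) ^ δ = T ((δ : ℤ) + 2 * k) + T (-((δ : ℤ) + 2 * k))
  | 0 => by simpa [vietaSeq] using h0
  | 1 => by simpa [vietaSeq] using h1
  | k + 2 => by
    have ha := aeval_vietaSeq P₀ P₁ δ h0 h1 (k + 1)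
    have hb := aeval_vietaSeq P₀ P₁ δ h0 h1 k
    rw [vietaSeq, map_sub, map_mul, Polynomial.aeval_X, sub_mul, mul_assoc, ha, hb]
    simp only [add_mul, mul_add, ← T_add]
    push_cast
    ring_nf

theorem exists_prod_X_sub_C (P : Polynomial ℂ) (hP : P.Monic) (n : ℕ) (hn : P.natDegree = n) :
    ∃ r : ℕ → ℂ, P = ∏ i ∈ Finset.range n, (Polynomial.X - Polynomial.C (r i)) := by
  have hs := IsAlgClosed.splits P
  set l := P.roots.toList with hl
  have hlen : l.length = n := by
    rw [hl, Multiset.length_toList, ← hs.natDegree_eq_card_roots, hn]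
  refine ⟨fun i => l.getD i 0, ?_⟩
  have h1 := hs.eq_prod_roots
  rw [hP.leadingCoeff, map_one, one_mul, ← Multiset.coe_toList P.roots, Multiset.map_coe,
    Multiset.prod_coe, ← hl, ← Fin.prod_univ_fun_getElem] at h1
  rw [h1, ← hlen, Finset.prod_range]
  simp

/-- Every palindromic Laurent polynomial `λ ^ N + λ ^ (-N) + ⋯` with exponents of the parity of `N`
is a product of factors `λ ^ 2 + λ ^ (-2) + u` and, for odd `N`, of `λ + λ⁻¹`. -/
theorem exists_palindromic_factorization (N : ℕ) (hN : 1 ≤ N) (y : ℕ → ℂ) :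
    ∃ u : ℕ → ℂ, (∏ p ∈ Finset.range (N / 2), (T 2 + T (-2) + C (u p))) *
        (T 1 + T (-1) : LaurentPolynomial ℂ) ^ (N % 2) =
      (T (N : ℤ) + T (-(N : ℤ))) + ∑ p ∈ Finset.range (N / 2),
        (T ((N : ℤ) - 2 * ((p : ℤ) + 1)) + T (2 * ((p : ℤ) + 1) - (N : ℤ))) * C (y p) := by
  obtain ⟨Q, hQdeg, hQmonic, hQ⟩ : ∃ Q : ℕ → Polynomial ℂ, (∀ k : ℕ, (Q k).degree ≤ (k : WithBot ℕ)) ∧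
      ((Q (N / 2)).Monic ∧ (Q (N / 2)).natDegree = N / 2) ∧
      ∀ k : ℕ, Polynomial.aeval (T 2 + T (-2) : LaurentPolynomial ℂ) (Q k) *
        (T 1 + T (-1)) ^ (N % 2) =
          T (((N % 2 : ℕ) : ℤ) + 2 * k) + T (-(((N % 2 : ℕ) : ℤ) + 2 * k)) := by
    rcases Nat.mod_two_eq_zero_or_one N with h | h
    · obtain ⟨m, hm⟩ : ∃ m, N / 2 = m + 1 := ⟨N / 2 - 1, by omega⟩
      have hd := vietaSeq_degree (Polynomial.C 2) Polynomial.X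
        Polynomial.degree_C_le Polynomial.monic_X
        Polynomial.degree_X
      refine ⟨vietaSeq (Polynomial.C 2) Polynomial.X, fun k => (hd k).1, ⟨?_, ?_⟩, ?_⟩
      · rw [hm]
        exact (hd m).2.1
      · rw [hm]
        exact Polynomial.natDegree_eq_of_degree_eq_some (hd m).2.2
      · rw [h]
        refine aeval_vietaSeq (Polynomial.C 2) Polynomial.X 0 ?_ ?_
        · rw [Polynomial.aeval_C, map_ofNat]
          simp [one_add_one_eq_two]
        · simp
    -- The second seed comes from `λ³ + λ⁻³ = (λ² + λ⁻² - 1)(λ + λ⁻¹)`.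
    · have hd := vietaSeq_degree 1 (Polynomial.X - Polynomial.C 1)
        (by simp) (Polynomial.monic_X_sub_C 1) (Polynomial.degree_X_sub_C 1)
      refine ⟨vietaSeq 1 (Polynomial.X - Polynomial.C 1), fun k => (hd k).1, ?_, ?_⟩
      · rcases Nat.eq_zero_or_pos (N / 2) with h0 | h0
        · rw [h0]
          exact ⟨Polynomial.monic_one, Polynomial.natDegree_one⟩
        · obtain ⟨m, hm⟩ : ∃ m, N / 2 = m + 1 := ⟨N / 2 - 1, by omega⟩
          rw [hm]
          exact ⟨(hd m).2.1, Polynomial.natDegree_eq_of_degree_eq_some (hd m).2.2⟩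
      · rw [h]
        refine aeval_vietaSeq 1 _ 1 ?_ ?_
        · simp
        · rw [map_sub, Polynomial.aeval_X, map_one, map_one, pow_one, sub_mul]
          simp only [add_mul, mul_add, ← T_add]
          norm_num
          abel
  set n := N / 2 with hn
  -- `Q n` carries the outer terms `λ^N + λ^(-N)` and `L` the prescribed inner ones. As `L` has
  -- smaller degree, `Q n + L` is monic of degree `n`, and its negated roots are the required `u`.
  set L : Polynomial ℂ := ∑ p ∈ Finset.range n, Polynomial.C (y p) * Q (n - (p + 1)) with hL
  have hLdeg : L.degree < (Q n).degree := by
    rw [Polynomial.degree_eq_natDegree hQmonic.1.ne_zero, hQmonic.2]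
    refine (Polynomial.degree_sum_le _ _).trans_lt ?_
    refine (Finset.sup_lt_iff (WithBot.bot_lt_coe _)).mpr fun p hp => ?_
    rw [Finset.mem_range] at hp
    refine lt_of_le_of_lt ((Polynomial.degree_mul_le _ _).trans
      (add_le_add Polynomial.degree_C_le (hQdeg _))) ?_
    rw [zero_add]
    exact_mod_cast (by omega : n - (p + 1) < n)
  obtain ⟨r, hr⟩ := exists_prod_X_sub_C (Q n + L) (hQmonic.1.add_of_left hLdeg) n (by
    rw [Polynomial.natDegree_add_eq_left_of_degree_lt hLdeg, hQmonic.2])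
  refine ⟨fun p => -r p, ?_⟩
  have h1 := congrArg (Polynomial.aeval (T 2 + T (-2) : LaurentPolynomial ℂ)) hr
  have hNn : ((N % 2 : ℕ) : ℤ) + 2 * (n : ℤ) = N := by omega
  rw [map_prod] at h1
  simp only [map_sub, Polynomial.aeval_X, Polynomial.aeval_C,
    LaurentPolynomial.algebraMap_apply, Algebra.algebraMap_self, RingHom.id_apply] at h1
  simp only [map_neg, ← sub_eq_add_neg]
  rw [← h1, map_add, add_mul, hQ, hNn, hL, map_sum, Finset.sum_mul]
  congr 1
  refine Finset.sum_congr rfl fun p hp => ?_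
  rw [Finset.mem_range] at hp
  have h2 : ((N % 2 : ℕ) : ℤ) + 2 * ((n - (p + 1) : ℕ) : ℤ) = N - 2 * ((p : ℤ) + 1) := by omega
  rw [map_mul, mul_assoc, hQ, h2, Polynomial.aeval_C, mul_comm,
    LaurentPolynomial.algebraMap_apply, Algebra.algebraMap_self, RingHom.id_apply, neg_sub]

end Palindromic

/-! ### Antidiagonal pairs with prescribed values of the Casimir functions -/

open LaurentPolynomial in
theorem coeff_palindromic (N : ℕ) (y : ℕ → ℂ) (p : Fin (N / 2)) :
    ((T (N : ℤ) + T (-(N : ℤ)) : LaurentPolynomial ℂ) + ∑ p ∈ Finset.range (N / 2),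
        (T ((N : ℤ) - 2 * ((p : ℤ) + 1)) + T (2 * ((p : ℤ) + 1) - (N : ℤ))) * C (y p)).coeff
      (2 * (((p : ℕ) + 1 : ℕ) : ℤ) - N) =
      y p * (if 2 * ((p : ℕ) + 1) = N then 2 else 1) := by
  have hp := p.2
  rw [AddMonoidAlgebra.coeff_add, Finsupp.add_apply, AddMonoidAlgebra.coeff_add, Finsupp.add_apply,
    T_apply, T_apply, if_neg (by omega), if_neg (by omega), add_zero, zero_add,
    AddMonoidAlgebra.coeff_sum, Finset.sum_apply', Finset.sum_eq_single (p : ℕ)]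
  · rw [mul_comm, mul_add, ← single_eq_C_mul_T, ← single_eq_C_mul_T,
      AddMonoidAlgebra.coeff_add, Finsupp.add_apply, AddMonoidAlgebra.coeff_single,
      AddMonoidAlgebra.coeff_single, Finsupp.single_apply, Finsupp.single_apply]
    rw [if_pos (show 2 * (((p : ℕ) : ℤ) + 1) - (N : ℤ) = _ by push_cast; ring)]
    by_cases h : 2 * ((p : ℕ) + 1) = N
    · rw [if_pos (by omega), if_pos h]
      ring
    · rw [if_neg (by omega), if_neg h]
      ring
  · intro b hb hbp
    rw [Finset.mem_range] at hb
    rw [mul_comm, mul_add, ← single_eq_C_mul_T, ← single_eq_C_mul_T,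
      AddMonoidAlgebra.coeff_add, Finsupp.add_apply, AddMonoidAlgebra.coeff_single,
      AddMonoidAlgebra.coeff_single, Finsupp.single_apply, Finsupp.single_apply,
      if_neg (by omega), if_neg (by omega), add_zero]
  · intro h
    exact absurd (Finset.mem_range.mpr hp) h

/-- This solves `u = t + t⁻¹`; the two roots of the quadratic have product `1`, so neither vanishes.
-/
theorem exists_sq_add_one_eq_mul (u : ℂ) : ∃ t : ℂ, t ≠ 0 ∧ t ^ 2 + 1 = t * u := by
  obtain ⟨s, hs⟩ := IsAlgClosed.exists_pow_nat_eq (u ^ 2 - 4) (n := 2) (by norm_num)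
  have h : (u + s) / 2 * ((u - s) / 2) = 1 := by linear_combination (-1 / 4) * hs
  refine ⟨(u + s) / 2, fun h0 => ?_, ?_⟩
  · rw [h0, zero_mul] at h
    exact zero_ne_one h
  · linear_combination (-1) * h

open LaurentPolynomial in
/-- The coefficients of `det (λ A + λ⁻¹ Aᵀ) / det A` can be prescribed by an antidiagonal matrix
`A`. -/
theorem exists_antidiagonal_pencilPoly (N : ℕ) (hN : 1 ≤ N) (y : ℕ → ℂ) :
    ∃ c : ℕ → ℂ, (∀ i, c i ≠ 0) ∧ ∀ p : Fin (N / 2),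
      (pencilPoly (antidiagonal fun i : Fin N => c i)).coeff ((p : ℕ) + 1) /
        (antidiagonal fun i : Fin N => c i).det / (if 2 * ((p : ℕ) + 1) = N then 2 else 1) =
          y p := by
  obtain ⟨u, hu⟩ := exists_palindromic_factorization N hN y
  choose t ht0 ht using fun p => exists_sq_add_one_eq_mul (u p)
  -- The mirror entries `t` and `1` contribute `(λt + λ⁻¹)(λ + λ⁻¹t) = t(λ² + λ⁻² + u)`; a central
  -- entry `1` contributes `λ + λ⁻¹`.
  set c : ℕ → ℂ := fun i => if i < N / 2 then t i else 1 with hc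
  have hc0 : ∀ i, c i ≠ 0 := by
    intro i
    simp only [hc]
    split_ifs
    · exact ht0 i
    · exact one_ne_zero
  have hlow : ∀ p ∈ Finset.range (N / 2), c p = t p := fun p hp => if_pos (Finset.mem_range.mp hp)
  have hhigh : ∀ p ∈ Finset.range (N / 2), c (N - 1 - p) = 1 := fun p hp =>
    if_neg (by rw [Finset.mem_range] at hp; omega)
  refine ⟨c, hc0, fun p => ?_⟩
  set A := antidiagonal fun i : Fin N => c i with hA
  have hdet : A.det = revSign ℂ N * ∏ p ∈ Finset.range (N / 2), t p := by
    rw [hA, det_antidiagonal, ← Finset.prod_range c, prod_range_fold]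
    have h1 : c (N / 2) = 1 := if_neg (lt_irrefl _)
    rw [h1, one_pow, mul_one]
    congr 1
    exact Finset.prod_congr rfl fun p hp => by rw [hlow p hp, hhigh p hp, mul_one]
  have hdet0 : A.det ≠ 0 := by
    rw [hdet]
    exact mul_ne_zero (revSign_ne_zero N) (Finset.prod_ne_zero_iff.mpr fun p _ => ht0 p)
  have hL : pencilLaurent A = C A.det * ((T (N : ℤ) + T (-(N : ℤ)) : LaurentPolynomial ℂ) +
      ∑ p ∈ Finset.range (N / 2),
        (T ((N : ℤ) - 2 * ((p : ℤ) + 1)) + T (2 * ((p : ℤ) + 1) - (N : ℤ))) * C (y p)) := by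
    rw [← hu, hA, pencilLaurent_antidiagonal, ← hA, hdet, map_mul, mul_assoc, map_prod, ← mul_assoc
      (∏ p ∈ Finset.range (N / 2), C (t p)), ← Finset.prod_mul_distrib]
    congr 1
    have h1 : ∏ i : Fin N, (T 1 * C (c i) + T (-1) * C (c (Fin.rev i)) : LaurentPolynomial ℂ) =
        ∏ i ∈ Finset.range N, (T 1 * C (c i) + T (-1) * C (c (N - 1 - i))) := by
      rw [Finset.prod_range]
      refine Finset.prod_congr rfl fun i _ => ?_
      rw [Fin.val_rev, Nat.sub_sub, add_comm 1]
    rw [h1, prod_range_fold]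
    congr 1
    · refine Finset.prod_congr rfl fun p hp => ?_
      have h2 : N - 1 - (N - 1 - p) = p := by
        rw [Finset.mem_range] at hp
        omega
      have h3 := congrArg (C : ℂ →+* LaurentPolynomial ℂ) (ht p)
      rw [map_add, map_pow, map_mul, map_one] at h3
      have h4 : (T 1 * T 1 : LaurentPolynomial ℂ) = T 2 := by rw [← T_add]; rfl
      have h5 : (T (-1) * T (-1) : LaurentPolynomial ℂ) = T (-2) := by rw [← T_add]; rfl
      have h6 : (T 1 * T (-1) : LaurentPolynomial ℂ) = 1 := by rw [← T_add]; rfl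
      rw [h2, hlow p hp, hhigh p hp, map_one]
      linear_combination h3 + C (t p) * h4 + C (t p) * h5 + (C (t p) ^ 2 + 1) * h6
    · rcases Nat.mod_two_eq_zero_or_one N with h | h
      · rw [h, pow_zero, pow_zero]
      · have h2 : N - 1 - N / 2 = N / 2 := by omega
        have h3 : c (N / 2) = 1 := if_neg (lt_irrefl _)
        rw [h2, h3, map_one, mul_one, mul_one]
  have hcoeff := coeff_sum_C_mul_T (N := N) (pencilPoly A).coeff
    (show (p : ℕ) + 1 ≤ N by have := p.2; omega)
  rw [← pencilLaurent_eq_sum, hL, ← smul_eq_C_mul, AddMonoidAlgebra.coeff_smul,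
    Finsupp.smul_apply, coeff_palindromic, smul_eq_mul] at hcoeff
  rw [← hcoeff]
  split_ifs <;> field_simp

/-- All values of the functions `Y_p` and all nonzero values of the functions `X_p` are taken. -/
theorem exists_point_hasValue (N : ℕ) (hN : 1 ≤ N) (y x : ℕ → ℂ) (hx : ∀ p, x p ≠ 0) :
    ∃ v : Coord N → ℂ, ∀ p : Fin (N / 2),
      HasValue v (casimirY p) (y p) ∧ HasValue v (casimirX p) (x p) := by
  obtain ⟨c, hc0, hc⟩ := exists_antidiagonal_pencilPoly N hN y
  -- `k q` is the upper-right `q × q` minor of `Aᵀ`.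
  set k : ℕ → ℂ := fun q => revSign ℂ q * ∏ i ∈ Finset.range q, c (N - 1 - i) with hk
  have hk0 : ∀ q, k q ≠ 0 := fun q =>
    mul_ne_zero (revSign_ne_zero q) (Finset.prod_ne_zero_iff.mpr fun i _ => hc0 _)
  have hkfin : ∀ q, k q = revSign ℂ q * ∏ i : Fin q, c (N - 1 - i) := fun q => by
    simp only [hk, Finset.prod_range]
  -- At the test point the `X`-function is `(σ_p σ_{N-p})² k_N / (k_{N-p} k_p)`, with `σ_q` the
  -- minors of `S`. In the middle case `2p = N` the two `σ` coincide, whence the fourth root.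
  have hroot : ∀ p : ℕ, ∃ w : ℂ, w ≠ 0 ∧ w ^ (if 2 * (p + 1) = N then 4 else 2) =
      x p * (k (N - (p + 1)) * k (p + 1)) / k N := by
    intro p
    have hpos : 0 < if 2 * (p + 1) = N then 4 else 2 := by split_ifs <;> norm_num
    obtain ⟨w, hw⟩ := IsAlgClosed.exists_pow_nat_eq
      (x p * (k (N - (p + 1)) * k (p + 1)) / k N) hpos
    refine ⟨w, fun h => ?_, hw⟩
    rw [h, zero_pow hpos.ne'] at hw
    exact div_ne_zero (mul_ne_zero (hx p) (mul_ne_zero (hk0 _) (hk0 _))) (hk0 _) hw.symm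
  choose w hw0 hw using hroot
  -- The prescribed leading minors of `S`. The value at `0` is the empty minor, and the value `1` at
  -- `N` makes `det B = det A`.
  set σ : ℕ → ℂ := fun q => if 1 ≤ q ∧ q ≤ N / 2 then w (q - 1) else 1 with hσ
  have hσ0 : ∀ q, σ q ≠ 0 := by
    intro q
    simp only [hσ]
    split_ifs
    · exact hw0 _
    · exact one_ne_zero
  have hσz : σ 0 = 1 := if_neg (by omega)
  have hσN : σ N = 1 := if_neg (by omega)
  set s : ℕ → ℂ := fun i => σ (i + 1) / σ i with hs
  have hs0 : ∀ i, s i ≠ 0 := fun i => div_ne_zero (hσ0 _) (hσ0 _)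
  have hsprod : ∀ q, ∏ i ∈ Finset.range q, s i = σ q := fun q => by
    induction q with
    | zero => simp [hσz]
    | succ q ih => rw [Finset.prod_range_succ, ih, hs, mul_div_cancel₀ _ (hσ0 q)]
  set A := antidiagonal fun i : Fin N => c i with hA
  -- Chosen so that `diag(s) B = Aᵀ`, that is, `S` becomes diagonal with leading minors `σ`.
  set B := antidiagonal fun i : Fin N => c (N - 1 - i) / s i with hB
  have hAT : A.transpose = antidiagonal fun i : Fin N => c (N - 1 - i) := by
    rw [hA, transpose_antidiagonal]
    congr 1
    ext i
    rw [Fin.val_rev, Nat.sub_sub, add_comm 1]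
  have hAdet : A.det = k N := by
    rw [← Matrix.det_transpose, hAT, det_antidiagonal, hkfin]
  have hminor : ∀ q (hq : q ≤ N), (B.submatrix (Fin.castLE hq)
      fun j : Fin q => (⟨N - q + j, by omega⟩ : Fin N)).det = k q / σ q := by
    intro q hq
    rw [hB, antidiagonal_submatrix, det_antidiagonal, ← hsprod, hkfin,
      Finset.prod_range, mul_div_assoc, ← Finset.prod_div_distrib]
    rfl
  have hBdet : B.det = k N := by
    rw [hB, det_antidiagonal, Finset.prod_div_distrib, ← Finset.prod_range s, hsprod, hσN,
      div_one, hkfin]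
  set S := Matrix.diagonal fun i : Fin N => s i with hS
  have hSB : S * B = A.transpose := by
    rw [hS, hB, diagonal_mul_antidiagonal, hAT]
    congr 1
    ext i
    rw [mul_div_cancel₀ _ (hs0 _)]
  have hSeq : S = A.transpose * B⁻¹ := by
    rw [← hSB, Matrix.mul_assoc, Matrix.mul_nonsing_inv _ (by
      rw [hBdet]; exact isUnit_iff_ne_zero.mpr (hk0 N)), Matrix.mul_one]
  have hSminor : ∀ q (hq : q ≤ N),
      (S.submatrix (Fin.castLE hq) (Fin.castLE hq)).det = σ q := by
    intro q hq
    rw [hS, Matrix.submatrix_diagonal _ _ (Fin.castLE_injective hq), Matrix.det_diagonal,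
      ← hsprod, Finset.prod_range]
    rfl
  refine ⟨matrixPoint A B, fun p => ⟨?_, ?_⟩⟩
  · rw [← hc p]
    exact hasValue_casimirY A B (by rw [hAdet]; exact hk0 N) p
  · have h := hasValue_casimirX A B S (by rw [hAdet]; exact hk0 N) (by rw [hBdet]; exact hk0 N)
      hSeq σ (fun q => k q / σ q) hSminor hminor (fun q => div_ne_zero (hk0 q) (hσ0 q)) p
    convert h using 1
    have hp := p.2
    have hσp : σ (p + 1) = w p := by
      simp only [hσ]
      rw [if_pos ⟨by omega, by omega⟩, Nat.add_sub_cancel]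
    have hwp := hw p
    rw [eq_div_iff (hk0 N)] at hwp
    have key : (σ (p + 1) * σ (N - (p + 1))) ^ 2 * k N = x p * (k (N - (p + 1)) * k (p + 1)) := by
      rw [← hwp, hσp]
      by_cases h2 : 2 * ((p : ℕ) + 1) = N
      · have h3 : N - ((p : ℕ) + 1) = p + 1 := by omega
        rw [if_pos h2, h3, hσp]
        ring
      · have h3 : σ (N - ((p : ℕ) + 1)) = 1 := if_neg (by omega)
        rw [if_neg h2, h3, mul_one]
    rw [hBdet, hAdet]
    have e1 := hk0 N
    have e2 := hk0 (N - (p + 1))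
    have e3 := hk0 (p + 1)
    have e4 := hσ0 (N - (p + 1))
    have e5 := hσ0 (p + 1)
    field_simp
    linear_combination -key

theorem algebraicIndependent_casimir (N : ℕ) (hN : 1 ≤ N) :
    AlgebraicIndependent ℂ
      (Sum.elim casimirY casimirX : Fin (N / 2) ⊕ Fin (N / 2) → RatFun N) := by
  refine algebraicIndependent_of_hasValue _ (Sum.elim (fun _ => Set.univ) fun _ => {0}ᶜ) ?_ ?_
  · rintro (i | i)
    · exact Set.infinite_univ
    · exact (Set.finite_singleton (0 : ℂ)).infinite_compl
  · intro z hz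
    obtain ⟨v, hv⟩ := exists_point_hasValue N hN
      (fun k => if h : k < N / 2 then z (Sum.inl ⟨k, h⟩) else 0)
      -- The padding value is `1` because every `x` must be nonzero, including those outside the
      -- range of `p`.
      (fun k => if h : k < N / 2 then z (Sum.inr ⟨k, h⟩) else 1) (by
        intro k
        split_ifs with h
        · exact hz (Sum.inr ⟨k, h⟩) (Set.mem_univ _)
        · exact one_ne_zero)
    refine ⟨v, ?_⟩
    rintro (p | p)
    · simpa using (hv p).1
    · simpa using (hv p).2

end

end BilinearPoisson

open BilinearPoisson LaurentPolynomial in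
theorem theorem5p2 (N : ℕ) (hN : 1 ≤ N) :
    charLaurent N =
        (T (N : ℤ) + T (-(N : ℤ))) +
          ∑ p : Fin (N / 2),
            (T ((N : ℤ) - 2 * ((p : ℤ) + 1)) + T (2 * ((p : ℤ) + 1) - (N : ℤ))) *
              C (casimirY p) ∧
      (∀ p : Fin (N / 2), IsCasimir (casimirY p)) ∧
      (∀ p : Fin (N / 2), IsCasimir (casimirX p)) ∧
      AlgebraicIndependent ℂ
        (Sum.elim casimirY casimirX : Fin (N / 2) ⊕ Fin (N / 2) → RatFun N) :=
  ⟨charLaurent_expansion hN, isCasimir_casimirY, isCasimir_casimirX,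
    algebraicIndependent_casimir N hN⟩
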